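/- **Setting.** Objects of integral length at least $1$ are stored in an array with cells $0,1,2,\dots$. An online sequence of requests inserts objects (under names not in use) and deletes active objects. Let $\Delta$ be the length of the longest object inserted so far, let $V$ be the total length of the active objects (inserted and not deleted), and let $\varepsilon'>0$ be a parameter. Size class $i\ge 1$ consists of the lengths $w$ with $2^{i-1}\le w<2^i$. **Data structure.** The array is divided into regions $1,2,\dots,\lfloor\log_2\Delta\rfloor+1$, one per size class, followed by a *tail buffer*. Region $i$ is a payload segment (only objects of class $i$) followed by a buffer segment (only items of classes $\le i$). All segments are empty at the start. - *Insertion when no flush is in progress.* The object, of length $w$ and class $i$, is appended to the earliest buffer of a class $j\ge i$ with $w$ unoccupied cells, or to the tail buffer if there is none. If it does not fit there either, it is placed at the end of the contents of the tail buffer, beyond its capacity, and a flush is triggered. - *Deletion when no flush is in progress.* The object leaves a hole, and a delete record of its length and class is put into a buffer by the same rule. If the record fits nowhere, it is not stored and a flush is triggered. - *Flush.* Let $b$ be the largest class such that the triggering object and all items in the tail buffer and in the buffers of classes $\ge b$ have class $\ge b$. Let $V(i)$ and $V_f$ be the volume of the active objects of class $i$ and of all active objects at the start of the flush (with the triggering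 request taken into account). The goal is that, for each $i\ge b$, the $i$th payload segment has length $V(i)$ and contains all objects of class $i$, that the $i$th buffer is empty and of length $\lfloor\varepsilon' V(i)\rfloor$, and that the tail buffer is empty and of length $\lfloor\varepsilon' V_f\rfloor$. Let $S$ be the end of the contents of the array if the tail buffer is counted up to its last item, and $S'$ the end of the tail buffer in the goal layout. Let $L=S-w$ and $L'=S'-w$ if the flush is triggered by the insertion of an object of length $w$, and $L=S$, $L'=S'$ if it is triggered by a deletion. Let $B$ be the total length of the flushed buffers including the tail buffer, and $T=\max\{L,L'\}+B+\Delta$. Holes and delete records of the flushed segments are dropped. Then the objects of the flushed buffers are moved to consecutive places from $T$ on; the flushed payload objects are packed to the left of $T$, from the last one to the first one; these are moved to their final places, from the first one to the last one; and the objects that came from buffers are moved to the ends of their payload segments. The cells behind the temporary working space (which ends where the objects moved behind $T$ end) form the *log*. Requests that arrive during the flush are appended to the log, where an insertion or deletion of an object of length $w$ takes $w$ cells. Finally the items of the log are re-inserted or re-deleted, in order, by the above rules for buffers; when the end of the log is reached the flush is complete and the log disappears. (The last item may trigger the next flush.) - *Deamortization.* On each request for an object of length $w$ that arrives during a flush,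 the next steps of the flush are performed until their volume (total length of the items moved) exceeds $(4/\varepsilon')w$ or no flush is in progress. There are two variants of the work on a flush by the request that triggers it: *eager*, where this request also spends its amount of work $(4/\varepsilon')w$, or what is left of it, on the new flush; and *lazy*, where only the subsequent requests work on the new flush. In the lazy variant, an object whose deletion has triggered a flush counts as active in $V$ until this flush completes. The *total space used* is the smallest number $m$ such that all segments, all stored items and, while a flush is in progress, its temporary working space and log lie in the cells $0,\dots,m-1$. **Lemma.** There is an absolute constant $C>0$ such that for all $0<\varepsilon'\le 1/4$, in both variants, and for every sequence of requests, the following holds after each request is processed. The total space used by the data structure is at most $(1+C\varepsilon')V+\Delta$. If no flush is in progress, it is at most $(1+C\varepsilon')V$. -/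

import Mathlib

namespace StorageRealloc

/-! ### Requests, active objects -/

/-- An online request: allocate a new object with a given name and (integral) length, or
deallocate the active object with a given name. -/
inductive Request where
  | insert (name length : ℕ)
  | delete (name : ℕ)

/-- The list of active objects, as pairs (name, length). -/
abbrev Directory := List (ℕ × ℕ)

/-- The active objects after one more request. -/
def Directory.update (d : Directory) : Request → Directory
  | .insert n w => (n, w) :: d
  | .delete n => d.filter (fun p => p.1 ≠ n)

/-- The length of the active object called `n`. -/
def Directory.lengthOf (d : Directory) (n : ℕ) : ℕ := (d.lookup n).getD 0

/-- A request sequence is legal if every inserted object has length at least `1` and a name that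
is not in use, and if only active objects are deleted. -/
def ValidFrom : Directory → List Request → Prop
  | _, [] => True
  | d, .insert n w :: rs =>
      1 ≤ w ∧ n ∉ d.map Prod.fst ∧ ValidFrom (d.update (.insert n w)) rs
  | d, .delete n :: rs => n ∈ d.map Prod.fst ∧ ValidFrom (d.update (.delete n)) rs

/-- A legal sequence of requests, starting with no objects. -/
def Valid (rs : List Request) : Prop := ValidFrom [] rs

/-- The total length `V` of the objects that are active after the requests `rs`. -/
def activeVolume (rs : List Request) : ℕ :=
  ((rs.foldl Directory.update []).map Prod.snd).sum

/-- The maximum of `Δ` and the length of the object in an insertion. -/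
def Request.maxLength (Δ : ℕ) : Request → ℕ
  | .insert _ w => max Δ w
  | .delete _ => Δ

/-- The length `Δ` of the longest object inserted by the requests `rs`. -/
def longest (rs : List Request) : ℕ := rs.foldl Request.maxLength 0

/-- The size class of an object of length `w ≥ 1`: the number `i` with `2^(i-1) ≤ w < 2^i`. -/
def sizeClass (w : ℕ) : ℕ := Nat.size w

/-! ### The contents of the array -/

/-- What an item stored in the array is: an object, an object whose deletion has been carried out
but whose cells have not been reclaimed yet (a hole), or a dummy delete record. -/
inductive Kind where
  | live
  | dead
  | record
  deriving DecidableEq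

/-- An item occupies the cells `addr, …, addr + size - 1`. -/
structure Item where
  name : ℕ
  size : ℕ
  addr : ℕ
  kind : Kind

/-- The total size of a list of items. -/
def vol (l : List Item) : ℕ := (l.map Item.size).sum

/-- The live objects in a list of items. -/
def live (l : List Item) : List Item := l.filter (fun x => x.kind = .live)

/-- The items of size class `i` in a list. -/
def ofClass (i : ℕ) (l : List Item) : List Item := l.filter (fun x => sizeClass x.size = i)

/-- The largest end point of an item in a list. -/
def lastCell (l : List Item) : ℕ := (l.map (fun x => x.addr + x.size)).foldr max 0

/-- The region of a size class: a payload segment of length `payCap` followed by a buffer segment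
of length `bufCap`, with their contents. -/
structure Region where
  payCap : ℕ
  bufCap : ℕ
  payload : List Item
  buffer : List Item

/-- The instruction to move the object `name`, of length `size`, to the address `target`. -/
structure Move where
  name : ℕ
  size : ℕ
  target : ℕ

/-- The plan of a flush: the boundary size class, the volumes `V(i)` and their sum `V_f` at the
start of the flush, and the moves that are still to be carried out. -/
structure Plan where
  boundary : ℕ
  classVol : ℕ → ℕ
  totalVol : ℕ
  moves : List Move

/-- Either no flush is in progress, or a flush is moving the objects it found, or it is moving the
contents of the log to the buffers. -/
inductive Phase where
  | idle
  | moving (p : Plan)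
  | draining

/-- No flush is in progress. -/
def Phase.IsIdle : Phase → Prop
  | .idle => True
  | _ => False

/-- The state of the data structure.  The regions of the size classes `1, 2, …` follow each other
from address `0` on, and the tail buffer follows them.  `overflow` holds the objects that a flush
has taken over from the buffers.  The log occupies the cells `logStart, …, logEnd - 1`; `log` is
the part of it that is not yet processed.  `pending` is the length of the object whose deletion
triggered the flush in progress (`0` if there is none). -/
structure State where
  active : Directory
  maxLen : ℕ
  region : ℕ → Region
  tailCap : ℕ
  tail : List Item
  phase : Phase
  overflow : List Item
  log : List Item
  logStart : ℕ
  logEnd : ℕ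
  pending : ℕ

/-- The empty data structure. -/
def State.init : State where
  active := []
  maxLen := 0
  region := fun _ => ⟨0, 0, [], []⟩
  tailCap := 0
  tail := []
  phase := .idle
  overflow := []
  log := []
  logStart := 0
  logEnd := 0
  pending := 0

/-- The number of size classes, `⌊lg Δ⌋ + 1` for `Δ ≥ 1`. -/
def State.numClasses (s : State) : ℕ := sizeClass s.maxLen

/-- The first cell of the region of class `i`. -/
def State.regionStart (s : State) (i : ℕ) : ℕ :=
  ∑ j ∈ Finset.range i, ((s.region j).payCap + (s.region j).bufCap)

/-- The first cell of the buffer segment of class `i`. -/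
def State.bufStart (s : State) (i : ℕ) : ℕ := s.regionStart i + (s.region i).payCap

/-- The first cell of the tail buffer. -/
def State.tailStart (s : State) : ℕ := s.regionStart (s.numClasses + 1)

/-- The end of the last segment. -/
def State.layoutEnd (s : State) : ℕ := s.tailStart + s.tailCap

/-- The items in the regions and in the tail buffer. -/
def State.mainItems (s : State) : List Item :=
  (List.range (s.numClasses + 1)).flatMap
    (fun i => (s.region i).payload ++ (s.region i).buffer) ++ s.tail

/-- The total space used: everything up to the end of the last segment, of the last stored item
and, while a flush is in progress, of its temporary working space and log. -/
def State.space (s : State) : ℕ :=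
  max s.layoutEnd
    (max (lastCell (s.mainItems ++ s.overflow ++ s.log))
      (match s.phase with
        | .idle => 0
        | _ => s.logEnd))

/-- Change every item in the regions, the tail buffer and the overflow list by `f`. -/
def State.mapItems (f : Item → Item) (s : State) : State :=
  { s with
    region := fun i =>
      { s.region i with
        payload := (s.region i).payload.map f
        buffer := (s.region i).buffer.map f }
    tail := s.tail.map f
    overflow := s.overflow.map f }

/-- Carry out a move. -/
def State.relocate (s : State) (m : Move) : State :=
  s.mapItems (fun x => if x.name = m.name ∧ x.kind = .live then { x with addr := m.target } else x)

/-- The object `n` becomes a hole. -/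
def State.markDead (s : State) (n : ℕ) : State :=
  s.mapItems (fun x => if x.name = n ∧ x.kind = .live then { x with kind := .dead } else x)

/-! ### Storing an item in a buffer -/

/-- The earliest buffer of a class `j ≥ sizeClass w` with `w` unoccupied cells. -/
def State.findBuffer (s : State) (w : ℕ) : Option ℕ :=
  (List.range (s.numClasses + 1)).find?
    (fun j => sizeClass w ≤ j ∧ vol (s.region j).buffer + w ≤ (s.region j).bufCap)

/-- Append an item to the buffer of class `j`. -/
def State.pushBuffer (s : State) (j : ℕ) (x : Item) : State :=
  { s with
    region := Function.update s.region j
      { s.region j with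
        buffer := (s.region j).buffer ++
          [{ x with addr := s.bufStart j + vol (s.region j).buffer }] } }

/-- Append an item to the tail buffer. -/
def State.pushTail (s : State) (x : Item) : State :=
  { s with tail := s.tail ++ [{ x with addr := s.tailStart + vol s.tail }] }

/-- Store an item at the end of the earliest buffer that can take it, the tail buffer being the
last one; `none` if there is no such buffer. -/
def State.tryStore (s : State) (x : Item) : Option State :=
  match s.findBuffer x.size with
  | some j => some (s.pushBuffer j x)
  | none => if vol s.tail + x.size ≤ s.tailCap then some (s.pushTail x) else none

/-! ### Planning a flush -/

/-- The class `b` is admissible as the boundary class: everything in the tail buffer and in the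
buffers of classes `≥ b` belongs to classes `≥ b`. -/
def State.Admissible (s : State) (b : ℕ) : Prop :=
  (∀ x ∈ s.tail, b ≤ sizeClass x.size) ∧
    ∀ j ∈ List.range (s.numClasses + 1), b ≤ j →
      ∀ x ∈ (s.region j).buffer, b ≤ sizeClass x.size

instance (s : State) : DecidablePred s.Admissible := fun b => by
  unfold State.Admissible; infer_instance

/-- The boundary class of a flush triggered by the insertion or deletion of an object of length
`w`: the largest admissible class that is at most the class of this object. -/
def State.boundary (s : State) (w : ℕ) : ℕ := Nat.findGreatest s.Admissible (sizeClass w)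

/-- The classes `b, b + 1, …` up to the last one. -/
def State.classesFrom (s : State) (b : ℕ) : List ℕ := List.range' b (s.numClasses + 1 - b)

/-- The volume `V(i)` of the live objects of class `i`. -/
def State.classVol (s : State) (i : ℕ) : ℕ := vol (ofClass i (live s.mainItems))

/-- The volume `V_f` of all live objects. -/
def State.totalVol (s : State) : ℕ := vol (live s.mainItems)

/-- The length of a buffer for a volume `v`. -/
noncomputable def bufLen (ε : ℝ) (v : ℕ) : ℕ := ⌊ε * v⌋₊

/-- The first cell of the region of class `i ≥ b` after a flush with boundary class `b`. -/
noncomputable def State.newStart (ε : ℝ) (s : State) (b i : ℕ) : ℕ :=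
  s.regionStart b + ∑ j ∈ Finset.Ico b i, (s.classVol j + bufLen ε (s.classVol j))

/-- The end of the last segment after a flush with boundary class `b`. -/
noncomputable def State.newEnd (ε : ℝ) (s : State) (b : ℕ) : ℕ :=
  s.newStart ε b (s.numClasses + 1) + bufLen ε s.totalVol

/-- The total length `B` of the buffers that take part in the flush. -/
def State.flushedBufs (s : State) (b : ℕ) : ℕ :=
  ((s.classesFrom b).map (fun i => (s.region i).bufCap)).sum + s.tailCap

/-- The live objects in the buffers that take part in the flush. -/
def State.buffered (s : State) (b : ℕ) : List Item :=
  (s.classesFrom b).flatMap (fun i => live (s.region i).buffer) ++ live s.tail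

/-- The moves that put the objects of a list next to each other, from address `a` on. -/
def layFrom : ℕ → List Item → List Move
  | _, [] => []
  | a, x :: xs => ⟨x.name, x.size, a⟩ :: layFrom (a + x.size) xs

/-- The address `max {L, L'} + B + Δ`, where `L` is the end of the contents of the array and `L'`
the end of the last segment after the flush, both reduced by the length `ins` of the inserted
object if the flush is triggered by an insertion (`ins = 0` otherwise). -/
noncomputable def State.pivot (ε : ℝ) (s : State) (b ins : ℕ) : ℕ :=
  max (s.tailStart + vol s.tail - ins) (s.newEnd ε b - ins) + s.flushedBufs b + s.maxLen

/-- The moves of a flush: the buffered objects go to the cells from the pivot `T` on; the payload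
objects are packed to the left of `T`, last object first; the payload objects go to their final
places, first object first; the buffered objects go to the ends of their payload segments. -/
noncomputable def State.flushMoves (ε : ℝ) (s : State) (b ins : ℕ) : List Move :=
  let T := s.pivot ε b ins
  let pay := (s.classesFrom b).flatMap (fun i => live (s.region i).payload)
  layFrom T (s.buffered b) ++
  (layFrom (T - vol pay) pay).reverse ++
  (s.classesFrom b).flatMap (fun i =>
    layFrom (s.newStart ε b i) (live (s.region i).payload)) ++
  (s.classesFrom b).flatMap (fun i =>
    layFrom (s.newStart ε b i + vol (live (s.region i).payload)) (ofClass i (s.buffered b)))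

/-- Start a flush that is triggered by the insertion (`isInsert = true`) or deletion of an object
of length `w`.  Holes and delete records in the flushed segments are dropped, and the log begins
right behind the temporary working space. -/
noncomputable def State.startFlush (ε : ℝ) (s : State) (w : ℕ) (isInsert : Bool) : State :=
  let b := s.boundary w
  let ins := if isInsert then w else 0
  let logStart := s.pivot ε b ins + vol (s.buffered b)
  { s with
    region := fun i =>
      if b ≤ i then
        { s.region i with payload := live (s.region i).payload, buffer := [] }
      else s.region i
    tail := []
    phase := .moving ⟨b, s.classVol, s.totalVol, s.flushMoves ε b ins⟩
    overflow := s.buffered b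
    logStart := logStart
    logEnd := logStart
    pending := if isInsert then 0 else w }

/-- The new segment boundaries take effect when all moves of the plan are done. -/
noncomputable def State.install (ε : ℝ) (s : State) (p : Plan) : State :=
  { s with
    region := fun i =>
      if p.boundary ≤ i then
        { payCap := p.classVol i
          bufCap := bufLen ε (p.classVol i)
          payload := (s.region i).payload ++ ofClass i s.overflow
          buffer := [] }
      else s.region i
    tailCap := bufLen ε p.totalVol
    tail := []
    overflow := []
    phase := .draining }

/-- The flush terminates when the log is completely processed; the log disappears. -/
def State.finish (s : State) : State :=
  match s.phase, s.log with
  | .draining, [] => { s with phase := .idle, logStart := 0, logEnd := 0, pending := 0 }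
  | _, _ => s

/-- The transitions of a flush that move no object. -/
noncomputable def State.settle (ε : ℝ) (s : State) : State :=
  match s.phase with
  | .moving p => if p.moves.isEmpty then (s.install ε p).finish else s
  | _ => s.finish

/-! ### Carrying out insertions and deletions -/

/-- Insert the object `n` of length `w` into the buffers.  If it does not fit, it is placed at the
end of the tail buffer, beyond its capacity, and a flush is triggered. -/
noncomputable def State.performInsert (ε : ℝ) (s : State) (n w : ℕ) : State :=
  match s.tryStore ⟨n, w, 0, .live⟩ with
  | some s' => s'
  | none => (s.pushTail ⟨n, w, 0, .live⟩).startFlush ε w true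

/-- Delete the object `n` of length `w`: it leaves a hole, and a delete record of length `w` is put
into the buffers.  If this record does not fit, it is not stored and a flush is triggered. -/
noncomputable def State.performDelete (ε : ℝ) (s : State) (n w : ℕ) : State :=
  match (s.markDead n).tryStore ⟨n, w, 0, .record⟩ with
  | some s' => s'
  | none => (s.markDead n).startFlush ε w false

/-- One step of the flush in progress, together with its volume: carry out the next move, or
re-insert / re-delete the first item of the log. -/
noncomputable def State.step (ε : ℝ) (s : State) : State × ℕ :=
  match s.phase, s.log with
  | .moving ⟨b, cv, tv, m :: ms⟩, _ =>
      ((({ s with phase := .moving ⟨b, cv, tv, ms⟩ } : State).relocate m).settle ε, m.size)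
  | .draining, x :: xs =>
      let s' : State := { s with log := xs }
      ((if x.kind = .live then s'.performInsert ε x.name x.size
        else s'.performDelete ε x.name x.size).settle ε, x.size)
  | _, _ => (s, 0)

/-- Passing from `s` to `s'`, the end of a flush has triggered the next one. -/
def triggered (s s' : State) : Bool :=
  match s.phase, s'.phase with
  | .draining, .moving _ => true
  | _, _ => false

/-- Perform steps of the flush in progress until their volume is at least `k` or no flush is in
progress.  If a new flush is triggered meanwhile, it is worked on with what is left of `k` if
`eager` holds, and not yet otherwise. -/
noncomputable def State.work (ε : ℝ) (eager : Bool) : ℕ → State → State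
  | 0, s => s
  | k + 1, s =>
    match s.phase with
    | .idle => s
    | _ =>
      let r := s.step ε
      if triggered s r.1 && !eager then r.1
      else State.work ε eager (k - (r.2 - 1)) r.1
termination_by k => k

/-- The least integral volume exceeding `(4/ε) w`. -/
noncomputable def workVolume (ε : ℝ) (w : ℕ) : ℕ := ⌊4 / ε * w⌋₊ + 1

/-- Append an item to the log. -/
def State.pushLog (s : State) (x : Item) : State :=
  { s with log := s.log ++ [{ x with addr := s.logEnd }], logEnd := s.logEnd + x.size }

/-- The length of the object that a request inserts or deletes. -/
def State.requestLength (s : State) : Request → ℕ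
  | .insert _ w => w
  | .delete n => s.active.lengthOf n

/-- Process a request.  If no flush is in progress, it is carried out at once; otherwise it is
placed at the end of the log.  On a request of length `w` that finds a flush in progress, just over
`(4/ε) w` steps by volume of the flush are performed.  The Boolean `eager` tells whether a request
that triggers a flush also spends its share of work on this flush (`true`), or whether only the
subsequent requests do (`false`). -/
noncomputable def State.process (ε : ℝ) (eager : Bool) (s : State) (r : Request) : State :=
  let w := s.requestLength r
  let s₀ : State := { s with active := s.active.update r, maxLen := r.maxLength s.maxLen }
  match s.phase with
  | .idle =>
      let s₁ := (match r with
        | .insert n _ => s₀.performInsert ε n w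
        | .delete n => s₀.performDelete ε n w).settle ε
      if eager then s₁.work ε eager (workVolume ε w) else s₁
  | _ =>
      (match r with
        | .insert n _ => s₀.pushLog ⟨n, w, 0, .live⟩
        | .delete n => s₀.pushLog ⟨n, w, 0, .record⟩).work ε eager (workVolume ε w)

/-- The state of the deamortized data structure after a sequence of requests. -/
noncomputable def run (ε : ℝ) (eager : Bool) (rs : List Request) : State :=
  rs.foldl (State.process ε eager) State.init

/-- The volume that counts as active.  If a request that triggers a flush does no work on it, then
the object whose deletion has triggered the flush in progress counts as active until the flush
completes. -/
noncomputable def countedVolume (ε : ℝ) (eager : Bool) (rs : List Request) : ℕ :=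
  if eager then activeVolume rs else activeVolume rs + (run ε eager rs).pending

end StorageRealloc

/-!
Between flushes, every segment is paid for: a payload segment is no longer than the active objects
of its class and the items of this class in the buffers, and each buffer is an `ε`-fraction of its
payload segment, the tail buffer an `ε`-fraction of all objects and buffered items.  Hence the
buffers hold `O(ε V)` cells, and the segments end before `(1 + O(ε)) V`.

During a flush, the working space ends at the pivot plus the volume of the flushed buffers, before
`(1 + O(ε)) V + Δ`, and the log follows.  Let `Vf` be the volume that the flush has found and `W`
the volume of the requests since then.  The flush moves each object twice and the items of the log
once, so its work is at most `2 Vf + W`, while the requests in the log have paid for `4 W / ε`.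
As long as the flush lasts, all requests before the last one have thus at most the volume `ε Vf`.
So the log is short, and the new tail buffer, of length `⌊ε Vf⌋`, has room for all items of the log
but the last one: the next flush is not triggered before the log is exhausted.

An object whose deletion has triggered the flush still takes up cells.  It is counted in the lazy
variant; in the eager one, the work paid for by this deletion shows that its length is `O(ε V)`.
-/

namespace StorageRealloc

/-! ### Volumes of lists of items and of multisets of objects -/

/-- The live objects of a list of items, as pairs (name, length). -/
def liveObjects (l : List Item) : Multiset (ℕ × ℕ) := ↑((live l).map fun x => (x.name, x.size))

/-- The total length of a multiset of objects. -/
def totalLength (M : Multiset (ℕ × ℕ)) : ℕ := (M.map Prod.snd).sum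

/-- The total length of the objects of class `i` in a multiset. -/
def classLength (i : ℕ) (M : Multiset (ℕ × ℕ)) : ℕ :=
  totalLength (M.filter fun p => sizeClass p.2 = i)

lemma sizeClass_mono {v w : ℕ} (h : v ≤ w) : sizeClass v ≤ sizeClass w := Nat.size_le_size h

@[simp] lemma vol_nil : vol [] = 0 := rfl

@[simp] lemma vol_cons (x : Item) (l : List Item) : vol (x :: l) = x.size + vol l := by
  simp [vol]

@[simp] lemma vol_append (l l' : List Item) : vol (l ++ l') = vol l + vol l' := by
  simp [vol]

lemma vol_perm {l l' : List Item} (h : l.Perm l') : vol l = vol l' := (h.map _).sum_eq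

lemma vol_flatMap {ι : Type*} (l : List ι) (f : ι → List Item) :
    vol (l.flatMap f) = (l.map fun i => vol (f i)).sum := by
  induction l with
  | nil => simp
  | cons a l ih => simp [ih]

lemma vol_map {f : Item → Item} (hf : ∀ x, (f x).size = x.size) (l : List Item) :
    vol (l.map f) = vol l := by
  simp [vol, Function.comp_def, hf]

@[simp] lemma live_nil : live [] = [] := rfl

@[simp] lemma live_append (l l' : List Item) : live (l ++ l') = live l ++ live l' := by
  simp [live]

@[simp] lemma live_live (l : List Item) : live (live l) = live l := by
  simp [live]

lemma mem_live {x : Item} {l : List Item} : x ∈ live l ↔ x ∈ l ∧ x.kind = .live := by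
  simp [live]

lemma live_eq_self {l : List Item} (h : ∀ x ∈ l, x.kind = .live) : live l = l := by
  simpa [live, List.filter_eq_self] using h

lemma vol_live_le (l : List Item) : vol (live l) ≤ vol l :=
  (List.filter_sublist.map Item.size).sum_le_sum (by simp)

@[simp] lemma ofClass_nil (i : ℕ) : ofClass i [] = [] := rfl

@[simp] lemma ofClass_append (i : ℕ) (l l' : List Item) :
    ofClass i (l ++ l') = ofClass i l ++ ofClass i l' := by
  simp [ofClass]

lemma mem_ofClass {i : ℕ} {x : Item} {l : List Item} :
    x ∈ ofClass i l ↔ x ∈ l ∧ sizeClass x.size = i := by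
  simp [ofClass]

lemma vol_ofClass_cons (i : ℕ) (x : Item) (l : List Item) :
    vol (ofClass i (x :: l)) =
      (if sizeClass x.size = i then x.size else 0) + vol (ofClass i l) := by
  by_cases h : sizeClass x.size = i <;> simp [ofClass, h]

lemma ofClass_eq_nil {i : ℕ} {l : List Item} (h : ∀ x ∈ l, sizeClass x.size ≠ i) :
    ofClass i l = [] := by
  simpa [ofClass, List.filter_eq_nil_iff] using h

lemma ofClass_eq_self {i : ℕ} {l : List Item} (h : ∀ x ∈ l, sizeClass x.size = i) :
    ofClass i l = l := by
  simpa [ofClass, List.filter_eq_self] using h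

lemma vol_ofClass_perm {l l' : List Item} (h : l.Perm l') (i : ℕ) :
    vol (ofClass i l) = vol (ofClass i l') := vol_perm (h.filter _)

lemma vol_ofClass_map {f : Item → Item} (hf : ∀ x, (f x).size = x.size) (i : ℕ)
    (l : List Item) : vol (ofClass i (l.map f)) = vol (ofClass i l) := by
  simp [vol, ofClass, List.filter_map, Function.comp_def, hf]

lemma sum_vol_ofClass_le (t : Finset ℕ) (l : List Item) :
    ∑ i ∈ t, vol (ofClass i l) ≤ vol l := by
  induction l with
  | nil => simp
  | cons x l ih =>
    simp only [vol_ofClass_cons, Finset.sum_add_distrib, Finset.sum_ite_eq, vol_cons]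
    split <;> omega

@[simp] lemma liveObjects_nil : liveObjects [] = 0 := rfl

@[simp] lemma liveObjects_append (l l' : List Item) :
    liveObjects (l ++ l') = liveObjects l + liveObjects l' := by
  simp [liveObjects, ← Multiset.coe_add]

@[simp] lemma liveObjects_live (l : List Item) : liveObjects (live l) = liveObjects l := by
  simp [liveObjects]

lemma liveObjects_cons (x : Item) (l : List Item) :
    liveObjects (x :: l) = if x.kind = .live then (x.name, x.size) ::ₘ liveObjects l
      else liveObjects l := by
  by_cases h : x.kind = .live <;> simp [liveObjects, live, h]

lemma liveObjects_cons_with_addr (x : Item) (a : ℕ) (l : List Item) :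
    liveObjects ({ x with addr := a } :: l) = liveObjects [x] + liveObjects l := by
  simp only [liveObjects_cons, liveObjects_nil]
  split <;> simp

lemma liveObjects_perm {l l' : List Item} (h : l.Perm l') : liveObjects l = liveObjects l' :=
  Multiset.coe_eq_coe.2 ((h.filter _).map _)

lemma liveObjects_flatMap {ι : Type*} (l : List ι) (f : ι → List Item) :
    liveObjects (l.flatMap f) = (l.map fun i => liveObjects (f i)).sum := by
  induction l with
  | nil => simp
  | cons a l ih => simp [ih]

lemma liveObjects_map {f : Item → Item}
    (hf : ∀ x, (f x).name = x.name ∧ (f x).size = x.size ∧ (f x).kind = x.kind)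
    (l : List Item) : liveObjects (l.map f) = liveObjects l := by
  induction l with
  | nil => rfl
  | cons x l ih =>
    obtain ⟨hname, hsize, hkind⟩ := hf x
    rw [List.map_cons, liveObjects_cons, liveObjects_cons, ih, hname, hsize, hkind]

lemma mem_liveObjects {x : Item} {l : List Item} (hx : x ∈ l) (hlive : x.kind = .live) :
    (x.name, x.size) ∈ liveObjects l := by
  simp only [liveObjects, Multiset.mem_coe, List.mem_map]
  exact ⟨x, mem_live.2 ⟨hx, hlive⟩, rfl⟩

@[simp] lemma totalLength_zero : totalLength 0 = 0 := rfl

@[simp] lemma totalLength_add (M N : Multiset (ℕ × ℕ)) :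
    totalLength (M + N) = totalLength M + totalLength N := by
  simp [totalLength]

@[simp] lemma totalLength_cons (p : ℕ × ℕ) (M : Multiset (ℕ × ℕ)) :
    totalLength (p ::ₘ M) = p.2 + totalLength M := by
  simp [totalLength]

@[simp] lemma classLength_zero (i : ℕ) : classLength i 0 = 0 := rfl

@[simp] lemma classLength_add (i : ℕ) (M N : Multiset (ℕ × ℕ)) :
    classLength i (M + N) = classLength i M + classLength i N := by
  simp [classLength]

lemma classLength_cons (i : ℕ) (p : ℕ × ℕ) (M : Multiset (ℕ × ℕ)) :
    classLength i (p ::ₘ M) = (if sizeClass p.2 = i then p.2 else 0) + classLength i M := by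
  by_cases h : sizeClass p.2 = i <;> simp [classLength, h]

lemma classLength_eq_zero {i : ℕ} {M : Multiset (ℕ × ℕ)} (h : ∀ p ∈ M, sizeClass p.2 ≠ i) :
    classLength i M = 0 := by
  have hfilter : M.filter (fun p => sizeClass p.2 = i) = 0 := by
    simpa [Multiset.filter_eq_nil] using h
  simp [classLength, hfilter]

lemma sum_classLength_le (t : Finset ℕ) (M : Multiset (ℕ × ℕ)) :
    ∑ i ∈ t, classLength i M ≤ totalLength M := by
  induction M using Multiset.induction_on with
  | empty => simp
  | cons p M ih =>
    simp only [classLength_cons, Finset.sum_add_distrib, Finset.sum_ite_eq, totalLength_cons]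
    split <;> omega

lemma vol_live_eq (l : List Item) : vol (live l) = totalLength (liveObjects l) := by
  simp [vol, totalLength, liveObjects, Function.comp_def]

lemma vol_ofClass_live_eq (i : ℕ) (l : List Item) :
    vol (ofClass i (live l)) = classLength i (liveObjects l) := by
  simp only [vol, classLength, totalLength, liveObjects, ofClass, Multiset.filter_coe,
    Multiset.map_coe, Multiset.sum_coe, List.filter_map, List.map_map]
  rfl

lemma lastCell_le {l : List Item} {a : ℕ} (h : ∀ x ∈ l, x.addr + x.size ≤ a) :
    lastCell l ≤ a := by
  induction l with
  | nil => simp [lastCell]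
  | cons x l ih =>
    simp only [lastCell, List.map_cons, List.foldr_cons, max_le_iff]
    exact ⟨h x (by simp), ih fun y hy => h y (by simp [hy])⟩

/-! ### Lists indexed by the size classes -/

lemma sum_map_range {α : Type*} [AddCommMonoid α] (n : ℕ) (f : ℕ → α) :
    ((List.range n).map f).sum = ∑ i ∈ Finset.range n, f i := rfl

lemma sum_range_extend {α : Type*} [AddCommMonoid α] {m n : ℕ} (h : m ≤ n) {f : ℕ → α}
    (hf : ∀ i, m < i → f i = 0) :
    ∑ i ∈ Finset.range (m + 1), f i = ∑ i ∈ Finset.range (n + 1), f i := by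
  refine Finset.sum_subset (by simpa using h) fun i _ hi => hf i ?_
  simp only [Finset.mem_range] at hi
  omega

lemma flatMap_range_extend {α : Type*} {m n : ℕ} (h : m ≤ n) {f : ℕ → List α}
    (hf : ∀ i, m < i → f i = []) :
    (List.range (m + 1)).flatMap f = (List.range (n + 1)).flatMap f := by
  induction n, h using Nat.le_induction with
  | base => rfl
  | succ n hmn ih => simp [ih, List.range_succ (n := n + 1), hf (n + 1) (by omega)]

lemma flatMap_range_perm_cons {α : Type*} {n j : ℕ} {f g : ℕ → List α} {x : α} (hj : j < n)
    (hgj : (g j).Perm (x :: f j)) (hg : ∀ i ≠ j, g i = f i) :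
    ((List.range n).flatMap g).Perm (x :: (List.range n).flatMap f) := by
  induction n with
  | zero => omega
  | succ n ih =>
    simp only [List.range_succ, List.flatMap_append, List.flatMap_singleton]
    rcases (Nat.lt_succ_iff_lt_or_eq.1 hj) with hj | rfl
    · rw [hg n (by omega)]
      exact (ih hj).append_right _
    · have hprefix : (List.range j).flatMap g = (List.range j).flatMap f :=
        List.flatMap_congr fun i hi => hg i (List.mem_range.1 hi).ne
      rw [hprefix]
      exact (hgj.append_left _).trans List.perm_middle

/-! ### Objects with distinct names -/

/-- Objects with distinct names and lengths from `1` to `Δ`, as the active ones always are. -/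
structure ProperObjects (M : Multiset (ℕ × ℕ)) (Δ : ℕ) : Prop where
  nodup : (M.map Prod.fst).Nodup
  length_mem : ∀ p ∈ M, 1 ≤ p.2 ∧ p.2 ≤ Δ

lemma ProperObjects.mono {M : Multiset (ℕ × ℕ)} {Δ Δ' : ℕ} (h : ProperObjects M Δ)
    (hle : Δ ≤ Δ') : ProperObjects M Δ' :=
  ⟨h.nodup, fun p hp => ⟨(h.length_mem p hp).1, (h.length_mem p hp).2.trans hle⟩⟩

lemma ProperObjects.cons {M : Multiset (ℕ × ℕ)} {Δ n w : ℕ} (h : ProperObjects M Δ)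
    (hn : n ∉ M.map Prod.fst) (hw : 1 ≤ w) (hwΔ : w ≤ Δ) : ProperObjects ((n, w) ::ₘ M) Δ := by
  refine ⟨by simp only [Multiset.map_cons, Multiset.nodup_cons]; exact ⟨hn, h.nodup⟩, ?_⟩
  intro p hp
  rcases Multiset.mem_cons.1 hp with rfl | hp
  exacts [⟨hw, hwΔ⟩, h.length_mem p hp]

lemma ProperObjects.filter {M : Multiset (ℕ × ℕ)} {Δ : ℕ} (h : ProperObjects M Δ)
    (P : ℕ × ℕ → Prop) [DecidablePred P] : ProperObjects (M.filter P) Δ :=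
  ⟨Multiset.nodup_of_le (Multiset.map_le_map (Multiset.filter_le _ _)) h.nodup,
    fun p hp => h.length_mem p (Multiset.mem_of_mem_filter hp)⟩

lemma eq_snd_of_nodup {M : Multiset (ℕ × ℕ)} (h : (M.map Prod.fst).Nodup) {n v w : ℕ}
    (hv : (n, v) ∈ M) (hw : (n, w) ∈ M) : v = w :=
  (Prod.mk.inj (Multiset.inj_on_of_nodup_map h _ hv _ hw rfl)).2

lemma cons_filter_fst_ne {M : Multiset (ℕ × ℕ)} (h : (M.map Prod.fst).Nodup) {n w : ℕ}
    (hw : (n, w) ∈ M) : (n, w) ::ₘ M.filter (fun p => p.1 ≠ n) = M := by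
  obtain ⟨N, rfl⟩ := Multiset.exists_cons_of_mem hw
  simp only [Multiset.map_cons, Multiset.nodup_cons] at h
  rw [Multiset.filter_cons_of_neg _ (by simp)]
  congr 1
  rw [Multiset.filter_eq_self]
  rintro p hp rfl
  exact h.1 (Multiset.mem_map_of_mem _ hp)

/-! ### Sequences of moves -/

/-- The total volume of a list of moves. -/
def moveVol (ms : List Move) : ℕ := (ms.map Move.size).sum

@[simp] lemma moveVol_nil : moveVol [] = 0 := rfl

@[simp] lemma moveVol_cons (m : Move) (ms : List Move) :
    moveVol (m :: ms) = m.size + moveVol ms := by simp [moveVol]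

@[simp] lemma moveVol_append (l l' : List Move) : moveVol (l ++ l') = moveVol l + moveVol l' := by
  simp [moveVol]

@[simp] lemma moveVol_reverse (l : List Move) : moveVol l.reverse = moveVol l := by
  simp [moveVol]

lemma moveVol_flatMap {ι : Type*} (l : List ι) (f : ι → List Move) :
    moveVol (l.flatMap f) = (l.map fun i => moveVol (f i)).sum := by
  induction l with
  | nil => simp
  | cons a l ih => simp [ih]

@[simp] lemma moveVol_layFrom (a : ℕ) (l : List Item) : moveVol (layFrom a l) = vol l := by
  induction l generalizing a with
  | nil => rfl
  | cons x l ih => simp [layFrom, ih]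

lemma of_mem_layFrom {a : ℕ} {l : List Item} {m : Move} (h : m ∈ layFrom a l) :
    ∃ y ∈ l, m.name = y.name ∧ m.size = y.size ∧ m.target + m.size ≤ a + vol l := by
  induction l generalizing a with
  | nil => simp [layFrom] at h
  | cons x l ih =>
    simp only [layFrom, List.mem_cons] at h
    rcases h with rfl | h
    · exact ⟨x, by simp, rfl, rfl, by simp⟩
    · obtain ⟨y, hy, hname, hsize, hend⟩ := ih h
      exact ⟨y, by simp [hy], hname, hsize, by rw [vol_cons]; omega⟩

lemma exists_mem_layFrom (a : ℕ) {l : List Item} {y : Item} (h : y ∈ l) :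
    ∃ m ∈ layFrom a l, m.name = y.name := by
  induction l generalizing a with
  | nil => simp at h
  | cons x l ih =>
    rcases List.mem_cons.1 h with rfl | h
    · exact ⟨⟨y.name, y.size, a⟩, by simp [layFrom], rfl⟩
    · obtain ⟨m, hm, hname⟩ := ih (a + x.size) h
      exact ⟨m, by simp [layFrom, hm], hname⟩

/-- The address at which a sequence of moves leaves the object called `n` that it finds at
address `a`. -/
def landing (ms : List Move) (n a : ℕ) : ℕ :=
  ms.foldl (fun a m => if m.name = n then m.target else a) a

lemma landing_eq_or_exists_mem (ms : List Move) (n a : ℕ) :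
    landing ms n a = a ∧ (∀ m ∈ ms, m.name ≠ n) ∨
      ∃ m ∈ ms, m.name = n ∧ landing ms n a = m.target := by
  induction ms generalizing a with
  | nil => simp [landing]
  | cons m ms ih =>
    by_cases hm : m.name = n
    · right
      rcases ih m.target with ⟨hland, -⟩ | ⟨m', hmem, hname, hland⟩
      · exact ⟨m, by simp, hm, by simpa [landing, hm] using hland⟩
      · exact ⟨m', by simp [hmem], hname, by simpa [landing, hm] using hland⟩
    · rcases ih a with ⟨hland, hne⟩ | ⟨m', hmem, hname, hland⟩
      · exact .inl ⟨by simpa [landing, hm] using hland, by simpa [hm] using hne⟩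
      · exact .inr ⟨m', by simp [hmem], hname, by simpa [landing, hm] using hland⟩

lemma landing_append_le {l l' : List Move} {n a v e : ℕ} (hex : ∃ m ∈ l', m.name = n)
    (h : ∀ m ∈ l', m.name = n → m.target + v ≤ e) : landing (l ++ l') n a + v ≤ e := by
  have happend : landing (l ++ l') n a = landing l' n (landing l n a) := by simp [landing]
  rw [happend]
  rcases landing_eq_or_exists_mem l' n (landing l n a) with ⟨-, hne⟩ | ⟨m, hmem, hname, hland⟩
  · obtain ⟨m, hm, hn⟩ := hex
    exact absurd hn (hne m hm)
  · rw [hland]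
    exact h m hmem hname

/-! ### The layout -/

/-- The items stored in a region. -/
def Region.items (r : Region) : List Item := r.payload ++ r.buffer

/-- The items in the buffers, including the tail buffer. -/
def State.bufferItems (s : State) : List Item :=
  (List.range (s.numClasses + 1)).flatMap (fun i => (s.region i).buffer) ++ s.tail

/-- The total length of the buffers, including the tail buffer. -/
def State.bufferSpace (s : State) : ℕ :=
  ∑ i ∈ Finset.range (s.numClasses + 1), (s.region i).bufCap + s.tailCap

lemma mem_mainItems {s : State} {x : Item} : x ∈ s.mainItems ↔
    (∃ i ≤ s.numClasses, x ∈ (s.region i).items) ∨ x ∈ s.tail := by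
  simp [State.mainItems, Region.items]

lemma liveObjects_mainItems (s : State) : liveObjects s.mainItems =
    ∑ i ∈ Finset.range (s.numClasses + 1), liveObjects (s.region i).items +
      liveObjects s.tail := by
  simp only [State.mainItems, liveObjects_append, liveObjects_flatMap, sum_map_range,
    Region.items]

lemma vol_bufferItems (s : State) : vol s.bufferItems =
    ∑ i ∈ Finset.range (s.numClasses + 1), vol (s.region i).buffer + vol s.tail := by
  simp only [State.bufferItems, vol_append, vol_flatMap, sum_map_range]

lemma regionStart_mono (s : State) {i j : ℕ} (h : i ≤ j) : s.regionStart i ≤ s.regionStart j :=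
  Finset.sum_le_sum_of_subset (by simpa using h)

lemma regionStart_succ (s : State) (i : ℕ) : s.regionStart (i + 1) =
    s.regionStart i + ((s.region i).payCap + (s.region i).bufCap) :=
  Finset.sum_range_succ _ _

lemma regionStart_congr {s s' : State} {i : ℕ} (h : ∀ j < i,
    (s'.region j).payCap = (s.region j).payCap ∧ (s'.region j).bufCap = (s.region j).bufCap) :
    s'.regionStart i = s.regionStart i :=
  Finset.sum_congr rfl fun j hj => by
    rw [(h j (Finset.mem_range.1 hj)).1, (h j (Finset.mem_range.1 hj)).2]

lemma layoutEnd_eq (s : State) : s.layoutEnd =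
    ∑ i ∈ Finset.range (s.numClasses + 1), (s.region i).payCap + s.bufferSpace := by
  rw [State.layoutEnd, State.tailStart, State.regionStart, Finset.sum_add_distrib,
    State.bufferSpace, add_assoc]

/-- What holds of the regions at all times: objects are where their class allows it, and the
buffers are short and not overfull. -/
structure Regular (ε : ℝ) (s : State) : Prop where
  region_eq_empty : ∀ i, s.numClasses < i → s.region i = ⟨0, 0, [], []⟩
  payload_class : ∀ i, ∀ x ∈ (s.region i).payload, sizeClass x.size = i
  buffer_class : ∀ i, ∀ x ∈ (s.region i).buffer, sizeClass x.size ≤ i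
  bufCap_le : ∀ i, ((s.region i).bufCap : ℝ) ≤ ε * (s.region i).payCap
  buffer_vol : ∀ i, vol (s.region i).buffer ≤ (s.region i).bufCap

/-- The state is well formed and stores exactly the objects `D`, outside of any flush; the tail
buffer is overfull by at most `ex`. -/
structure Stored (ε : ℝ) (ex : ℕ) (s : State) (D : Multiset (ℕ × ℕ)) : Prop
    extends Regular ε s where
  proper : ProperObjects D s.maxLen
  objects_eq : liveObjects s.mainItems = D
  item_end : ∀ i, ∀ x ∈ (s.region i).items, x.addr + x.size ≤ s.regionStart (i + 1)
  tail_end : ∀ x ∈ s.tail, x.addr + x.size ≤ s.layoutEnd + ex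
  tail_vol : vol s.tail ≤ s.tailCap + ex

/-- The lengths of the segments are paid for by the objects of `M` and the items in the buffers:
a payload segment by those of its own class, the tail buffer by an `ε` fraction of everything. -/
structure Budget (ε : ℝ) (s : State) (M : Multiset (ℕ × ℕ)) : Prop where
  payCap_le : ∀ i, (s.region i).payCap ≤ classLength i M + vol (ofClass i s.bufferItems)
  tailCap_le : (s.tailCap : ℝ) ≤ ε * (totalLength M + vol s.bufferItems : ℕ)

lemma Regular.le_numClasses {ε : ℝ} {s : State} (h : Regular ε s) {i : ℕ} {x : Item}
    (hx : x ∈ (s.region i).items) : i ≤ s.numClasses := by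
  by_contra hi
  simp [h.region_eq_empty i (by omega), Region.items] at hx

lemma Regular.mem_mainItems {ε : ℝ} {s : State} (h : Regular ε s) {i : ℕ} {x : Item}
    (hx : x ∈ (s.region i).items) : x ∈ s.mainItems :=
  StorageRealloc.mem_mainItems.2 (.inl ⟨i, h.le_numClasses hx, hx⟩)

lemma Stored.mem_objects {ε : ℝ} {ex : ℕ} {s : State} {D : Multiset (ℕ × ℕ)}
    (h : Stored ε ex s D) {x : Item} (hx : x ∈ s.mainItems) (hlive : x.kind = .live) :
    (x.name, x.size) ∈ D :=
  h.objects_eq ▸ mem_liveObjects hx hlive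

lemma Stored.mainItem_end {ε : ℝ} {ex : ℕ} {s : State} {D : Multiset (ℕ × ℕ)}
    (h : Stored ε ex s D) {x : Item} (hx : x ∈ s.mainItems) :
    x.addr + x.size ≤ s.layoutEnd + ex := by
  rcases mem_mainItems.1 hx with ⟨i, hi, hx⟩ | hx
  · have hend := h.item_end i x hx
    have hmono : s.regionStart (i + 1) ≤ s.tailStart := regionStart_mono s (by omega)
    rw [State.layoutEnd]
    omega
  · exact h.tail_end x hx

lemma Budget.mono {ε : ℝ} {s : State} {M N : Multiset (ℕ × ℕ)} (hε : 0 < ε) (h : Budget ε s M) :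
    Budget ε s (N + M) where
  payCap_le i := (h.payCap_le i).trans (by simp)
  tailCap_le := h.tailCap_le.trans (by gcongr; simp)

lemma Budget.sum_payCap_le {ε : ℝ} {s : State} {M : Multiset (ℕ × ℕ)} (h : Budget ε s M) :
    ∑ i ∈ Finset.range (s.numClasses + 1), (s.region i).payCap ≤
      totalLength M + vol s.bufferItems := by
  refine (Finset.sum_le_sum fun i _ => h.payCap_le i).trans ?_
  rw [Finset.sum_add_distrib]
  exact Nat.add_le_add (sum_classLength_le _ _) (sum_vol_ofClass_le _ _)

lemma Regular.vol_bufferItems_le {ε : ℝ} {s : State} (h : Regular ε s)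
    (htail : vol s.tail ≤ s.tailCap) : vol s.bufferItems ≤ s.bufferSpace := by
  rw [vol_bufferItems]
  exact Nat.add_le_add (Finset.sum_le_sum fun i _ => h.buffer_vol i) htail

lemma Budget.bufferSpace_le_charge {ε : ℝ} {s : State} {M : Multiset (ℕ × ℕ)} (hε : 0 < ε)
    (h : Budget ε s M) (hreg : Regular ε s) :
    (s.bufferSpace : ℝ) ≤ 2 * ε * (totalLength M + vol s.bufferItems : ℕ) := by
  have hbuffers : ((∑ i ∈ Finset.range (s.numClasses + 1), (s.region i).bufCap : ℕ) : ℝ) ≤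
      ε * (∑ i ∈ Finset.range (s.numClasses + 1), (s.region i).payCap : ℕ) := by
    push_cast
    rw [Finset.mul_sum]
    exact Finset.sum_le_sum fun i _ => hreg.bufCap_le i
  have hpayloads := mul_le_mul_of_nonneg_left (Nat.cast_le (α := ℝ).2 h.sum_payCap_le) hε.le
  have htail := h.tailCap_le
  rw [State.bufferSpace, Nat.cast_add]
  linarith

lemma Budget.charge_le {ε : ℝ} {s : State} {M : Multiset (ℕ × ℕ)} (hε : 0 < ε)
    (hε' : ε ≤ 1 / 4) (h : Budget ε s M) (hreg : Regular ε s) (htail : vol s.tail ≤ s.tailCap) :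
    ((totalLength M + vol s.bufferItems : ℕ) : ℝ) ≤ 2 * totalLength M := by
  have hspace := h.bufferSpace_le_charge hε hreg
  have hvol : (vol s.bufferItems : ℝ) ≤ s.bufferSpace := by
    exact_mod_cast hreg.vol_bufferItems_le htail
  push_cast at hspace ⊢
  nlinarith

lemma Budget.bufferSpace_le {ε : ℝ} {s : State} {M : Multiset (ℕ × ℕ)} (hε : 0 < ε)
    (hε' : ε ≤ 1 / 4) (h : Budget ε s M) (hreg : Regular ε s) (htail : vol s.tail ≤ s.tailCap) :
    (s.bufferSpace : ℝ) ≤ 4 * ε * totalLength M := by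
  have hcharge := h.charge_le hε hε' hreg htail
  have hspace := h.bufferSpace_le_charge hε hreg
  nlinarith

lemma Budget.layoutEnd_le {ε : ℝ} {s : State} {M : Multiset (ℕ × ℕ)} (hε : 0 < ε)
    (hε' : ε ≤ 1 / 4) (h : Budget ε s M) (hreg : Regular ε s) (htail : vol s.tail ≤ s.tailCap) :
    (s.layoutEnd : ℝ) ≤ (1 + 8 * ε) * totalLength M := by
  have hpay : ((∑ i ∈ Finset.range (s.numClasses + 1), (s.region i).payCap : ℕ) : ℝ) ≤
      totalLength M + vol s.bufferItems := by
    exact_mod_cast h.sum_payCap_le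
  have hvol : (vol s.bufferItems : ℝ) ≤ s.bufferSpace := by
    exact_mod_cast hreg.vol_bufferItems_le htail
  have hspace := h.bufferSpace_le hε hε' hreg htail
  rw [layoutEnd_eq, Nat.cast_add]
  linarith

/-! ### Turning an object into a hole -/

/-- The effect on an item of turning the object `n` into a hole. -/
def Item.bury (n : ℕ) (x : Item) : Item :=
  if x.name = n ∧ x.kind = .live then { x with kind := .dead } else x

lemma Item.size_bury (n : ℕ) (x : Item) : (x.bury n).size = x.size := by
  unfold Item.bury; split <;> rfl

lemma Item.addr_bury (n : ℕ) (x : Item) : (x.bury n).addr = x.addr := by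
  unfold Item.bury; split <;> rfl

lemma liveObjects_map_bury (n : ℕ) (l : List Item) :
    liveObjects (l.map (Item.bury n)) = (liveObjects l).filter fun p => p.1 ≠ n := by
  induction l with
  | nil => rfl
  | cons x l ih =>
    rw [List.map_cons, liveObjects_cons, liveObjects_cons, ih]
    by_cases hlive : x.kind = .live <;> by_cases hname : x.name = n <;>
      simp [Item.bury, hlive, hname]

lemma markDead_eq (s : State) (n : ℕ) : s.markDead n = s.mapItems (Item.bury n) := rfl

lemma items_mapItems (f : Item → Item) (s : State) (i : ℕ) :
    ((s.mapItems f).region i).items = (s.region i).items.map f := by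
  simp [State.mapItems, Region.items]

lemma mainItems_mapItems (f : Item → Item) (s : State) :
    (s.mapItems f).mainItems = s.mainItems.map f := by
  simp only [State.mainItems, State.mapItems, State.numClasses, List.map_append,
    List.map_flatMap]

lemma bufferItems_mapItems (f : Item → Item) (s : State) :
    (s.mapItems f).bufferItems = s.bufferItems.map f := by
  simp only [State.bufferItems, State.mapItems, State.numClasses, List.map_append,
    List.map_flatMap]

lemma Regular.mapItems {ε : ℝ} {s : State} (h : Regular ε s) {f : Item → Item}
    (hf : ∀ x, (f x).size = x.size) : Regular ε (s.mapItems f) where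
  region_eq_empty i hi := by simp [State.mapItems, h.region_eq_empty i hi]
  payload_class i := List.forall_mem_map.2 fun x hx => hf x ▸ h.payload_class i x hx
  buffer_class i := List.forall_mem_map.2 fun x hx => hf x ▸ h.buffer_class i x hx
  bufCap_le := h.bufCap_le
  buffer_vol i := (vol_map hf _).trans_le (h.buffer_vol i)

lemma Budget.mapItems {ε : ℝ} {s : State} {M : Multiset (ℕ × ℕ)} (h : Budget ε s M)
    {f : Item → Item} (hf : ∀ x, (f x).size = x.size) : Budget ε (s.mapItems f) M where
  payCap_le i := by
    rw [bufferItems_mapItems, vol_ofClass_map hf]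
    exact h.payCap_le i
  tailCap_le := by
    rw [bufferItems_mapItems, vol_map hf]
    exact h.tailCap_le

lemma Stored.markDead {ε : ℝ} {ex : ℕ} {s : State} {D : Multiset (ℕ × ℕ)}
    (h : Stored ε ex s D) (n : ℕ) :
    Stored ε ex (s.markDead n) (D.filter fun p => p.1 ≠ n) where
  toRegular := h.toRegular.mapItems (Item.size_bury n)
  proper := h.proper.filter _
  objects_eq := by
    rw [markDead_eq, mainItems_mapItems, liveObjects_map_bury, h.objects_eq]
  item_end i := by
    rw [markDead_eq, items_mapItems]
    refine List.forall_mem_map.2 fun x hx => ?_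
    rw [Item.addr_bury, Item.size_bury]
    exact h.item_end i x hx
  tail_end := by
    refine List.forall_mem_map.2 fun x hx => ?_
    change (x.bury n).addr + (x.bury n).size ≤ _
    rw [Item.addr_bury, Item.size_bury]
    exact h.tail_end x hx
  tail_vol := (vol_map (Item.size_bury n) _).trans_le h.tail_vol

/-! ### Storing items in buffers -/

@[simp] lemma payCap_pushBuffer (s : State) (j i : ℕ) (x : Item) :
    ((s.pushBuffer j x).region i).payCap = (s.region i).payCap := by
  by_cases h : i = j <;> simp [State.pushBuffer, h]

@[simp] lemma bufCap_pushBuffer (s : State) (j i : ℕ) (x : Item) :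
    ((s.pushBuffer j x).region i).bufCap = (s.region i).bufCap := by
  by_cases h : i = j <;> simp [State.pushBuffer, h]

@[simp] lemma payload_pushBuffer (s : State) (j i : ℕ) (x : Item) :
    ((s.pushBuffer j x).region i).payload = (s.region i).payload := by
  by_cases h : i = j <;> simp [State.pushBuffer, h]

@[simp] lemma buffer_pushBuffer_self (s : State) (j : ℕ) (x : Item) :
    ((s.pushBuffer j x).region j).buffer = (s.region j).buffer ++
      [{ x with addr := s.bufStart j + vol (s.region j).buffer }] := by
  simp [State.pushBuffer]

lemma region_pushBuffer_of_ne (s : State) {i j : ℕ} (h : i ≠ j) (x : Item) :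
    (s.pushBuffer j x).region i = s.region i := by
  simp [State.pushBuffer, h]

lemma regionStart_pushBuffer (s : State) (j i : ℕ) (x : Item) :
    (s.pushBuffer j x).regionStart i = s.regionStart i :=
  regionStart_congr fun k _ => by simp

lemma layoutEnd_pushBuffer (s : State) (j : ℕ) (x : Item) :
    (s.pushBuffer j x).layoutEnd = s.layoutEnd := by
  have hstart := regionStart_pushBuffer s j (s.numClasses + 1) x
  exact congrArg (· + s.tailCap) hstart

lemma items_pushBuffer_self (s : State) (j : ℕ) (x : Item) :
    ((s.pushBuffer j x).region j).items = (s.region j).items ++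
      [{ x with addr := s.bufStart j + vol (s.region j).buffer }] := by
  simp [Region.items]

lemma mainItems_pushBuffer_perm (s : State) {j : ℕ} (hj : j ≤ s.numClasses) (x : Item) :
    (s.pushBuffer j x).mainItems.Perm
      ({ x with addr := s.bufStart j + vol (s.region j).buffer } :: s.mainItems) := by
  have hitems := items_pushBuffer_self s j x
  unfold Region.items at hitems
  refine (flatMap_range_perm_cons (Nat.lt_succ_of_le hj) ?_ fun i hi => ?_).append_right s.tail
  · rw [hitems]
    exact List.perm_append_singleton _ _
  · rw [region_pushBuffer_of_ne s hi]

lemma bufferItems_pushBuffer_perm (s : State) {j : ℕ} (hj : j ≤ s.numClasses) (x : Item) :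
    (s.pushBuffer j x).bufferItems.Perm
      ({ x with addr := s.bufStart j + vol (s.region j).buffer } :: s.bufferItems) := by
  refine (flatMap_range_perm_cons (Nat.lt_succ_of_le hj) ?_ fun i hi => ?_).append_right s.tail
  · rw [buffer_pushBuffer_self]
    exact List.perm_append_singleton _ _
  · rw [region_pushBuffer_of_ne s hi]

lemma mainItems_pushTail (s : State) (x : Item) : (s.pushTail x).mainItems =
    s.mainItems ++ [{ x with addr := s.tailStart + vol s.tail }] :=
  (List.append_assoc _ _ _).symm

lemma bufferItems_pushTail (s : State) (x : Item) : (s.pushTail x).bufferItems =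
    s.bufferItems ++ [{ x with addr := s.tailStart + vol s.tail }] :=
  (List.append_assoc _ _ _).symm

lemma Regular.pushBuffer {ε : ℝ} {s : State} (h : Regular ε s) {j : ℕ} {x : Item}
    (hj : j ≤ s.numClasses) (hclass : sizeClass x.size ≤ j)
    (hfit : vol (s.region j).buffer + x.size ≤ (s.region j).bufCap) :
    Regular ε (s.pushBuffer j x) where
  region_eq_empty i hi := by
    have hne : i ≠ j := by rintro rfl; exact absurd (hj.trans_lt hi) (lt_irrefl _)
    rw [region_pushBuffer_of_ne s hne]
    exact h.region_eq_empty i hi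
  payload_class i y hy := h.payload_class i y (by simpa using hy)
  buffer_class i := by
    rcases eq_or_ne i j with rfl | hne
    · simp only [buffer_pushBuffer_self, List.forall_mem_append, List.forall_mem_singleton]
      exact ⟨h.buffer_class i, hclass⟩
    · rw [region_pushBuffer_of_ne s hne]
      exact h.buffer_class i
  bufCap_le i := by simpa using h.bufCap_le i
  buffer_vol i := by
    rcases eq_or_ne i j with rfl | hne
    · simpa using hfit
    · rw [region_pushBuffer_of_ne s hne]
      exact h.buffer_vol i

lemma Stored.pushBuffer {ε : ℝ} {ex : ℕ} {s : State} {D : Multiset (ℕ × ℕ)}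
    (h : Stored ε ex s D) {j : ℕ} {x : Item}
    (hj : j ≤ s.numClasses) (hclass : sizeClass x.size ≤ j)
    (hfit : vol (s.region j).buffer + x.size ≤ (s.region j).bufCap)
    (hproper : ProperObjects (liveObjects [x] + D) s.maxLen) :
    Stored ε ex (s.pushBuffer j x) (liveObjects [x] + D) where
  toRegular := h.toRegular.pushBuffer hj hclass hfit
  proper := hproper
  objects_eq := by
    rw [liveObjects_perm (mainItems_pushBuffer_perm s hj x), liveObjects_cons_with_addr,
      h.objects_eq]
  item_end i := by
    rw [regionStart_pushBuffer]
    rcases eq_or_ne i j with rfl | hne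
    · simp only [items_pushBuffer_self, List.forall_mem_append, List.forall_mem_singleton]
      refine ⟨h.item_end i, ?_⟩
      rw [State.bufStart, regionStart_succ]
      omega
    · rw [region_pushBuffer_of_ne s hne]
      exact h.item_end i
  tail_end := by
    rw [layoutEnd_pushBuffer]
    exact h.tail_end
  tail_vol := h.tail_vol

lemma Stored.pushTail {ε : ℝ} {ex ex' : ℕ} {s : State} {D : Multiset (ℕ × ℕ)}
    (h : Stored ε ex s D) (hex : ex ≤ ex') {x : Item}
    (hfit : vol s.tail + x.size ≤ s.tailCap + ex')
    (hproper : ProperObjects (liveObjects [x] + D) s.maxLen) :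
    Stored ε ex' (s.pushTail x) (liveObjects [x] + D) where
  toRegular := { h.toRegular with }
  proper := hproper
  objects_eq := by
    rw [mainItems_pushTail, liveObjects_append, liveObjects_cons_with_addr, h.objects_eq,
      liveObjects_nil, add_zero, add_comm]
  item_end := h.item_end
  tail_end := by
    refine List.forall_mem_append.2 ⟨fun y hy => (h.tail_end y hy).trans ?_, ?_⟩
    · exact Nat.add_le_add_left hex _
    · rw [List.forall_mem_singleton]
      change s.tailStart + vol s.tail + x.size ≤ s.tailStart + s.tailCap + ex'
      omega
  tail_vol := by simpa [State.pushTail] using hfit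

lemma Budget.of_bufferItems_perm_cons {ε : ℝ} {s s' : State} {M : Multiset (ℕ × ℕ)}
    {p : ℕ × ℕ} {x : Item} (h : Budget ε s (p ::ₘ M))
    (hperm : s'.bufferItems.Perm (x :: s.bufferItems)) (hsize : x.size = p.2)
    (hpay : ∀ i, (s'.region i).payCap = (s.region i).payCap) (htail : s'.tailCap = s.tailCap) :
    Budget ε s' M where
  payCap_le i := by
    have hle := h.payCap_le i
    rw [classLength_cons] at hle
    rw [hpay, vol_ofClass_perm hperm, vol_ofClass_cons, hsize]
    omega
  tailCap_le := by
    rw [htail, vol_perm hperm, vol_cons, hsize, add_left_comm, ← add_assoc]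
    simpa only [totalLength_cons] using h.tailCap_le

/-- The state `r` arises from `s` by storing an item of length `w` in a buffer, and its objects
are then `D`. -/
structure StoresInto (ε : ℝ) (s : State) (w : ℕ) (D : Multiset (ℕ × ℕ)) (r : State) : Prop where
  eq_with : ∃ reg tl, r = { s with region := reg, tail := tl }
  stored : Stored ε 0 r D
  budget : Budget ε r D
  tail_vol_le : vol r.tail ≤ vol s.tail + w
  layoutEnd_eq : r.layoutEnd = s.layoutEnd

lemma StoresInto.of_tryStore_eq_some {ε : ℝ} {s s' : State} {x : Item} {D : Multiset (ℕ × ℕ)}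
    (h : Stored ε 0 s D) (hb : Budget ε s ((x.name, x.size) ::ₘ (liveObjects [x] + D)))
    (hproper : ProperObjects (liveObjects [x] + D) s.maxLen) (hs : s.tryStore x = some s') :
    StoresInto ε s x.size (liveObjects [x] + D) s' := by
  unfold State.tryStore at hs
  split at hs
  · rename_i j hj
    obtain rfl := Option.some.inj hs
    have hmem := List.mem_of_find?_eq_some hj
    have hfind := List.find?_some hj
    simp only [decide_eq_true_eq] at hfind
    have hle : j ≤ s.numClasses := Nat.lt_succ_iff.1 (List.mem_range.1 hmem)
    exact ⟨⟨_, _, rfl⟩, h.pushBuffer hle hfind.1 hfind.2 hproper,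
      hb.of_bufferItems_perm_cons (bufferItems_pushBuffer_perm s hle x) rfl (by simp) rfl,
      Nat.le_add_right _ _, layoutEnd_pushBuffer s j x⟩
  · split at hs
    · rename_i hfit
      obtain rfl := Option.some.inj hs
      have hperm : (s.pushTail x).bufferItems.Perm
          ({ x with addr := s.tailStart + vol s.tail } :: s.bufferItems) := by
        rw [bufferItems_pushTail]
        exact List.perm_append_singleton _ _
      exact ⟨⟨_, _, rfl⟩, h.pushTail le_rfl (by simpa using hfit) hproper,
        hb.of_bufferItems_perm_cons hperm rfl (fun _ => rfl) rfl, by simp [State.pushTail], rfl⟩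
    · cases hs

lemma tailCap_lt_of_tryStore_eq_none {s : State} {x : Item} (h : s.tryStore x = none) :
    s.tailCap < vol s.tail + x.size := by
  unfold State.tryStore at h
  split at h
  · cases h
  · split at h
    · cases h
    · omega

/-! ### The layout during a flush -/

/-- The first cell of the region of class `i ≥ p.boundary` in the layout that the plan `p` brings
about. -/
noncomputable def goalStart (ε : ℝ) (s : State) (p : Plan) (i : ℕ) : ℕ :=
  s.regionStart p.boundary +
    ∑ j ∈ Finset.Ico p.boundary i, (p.classVol j + bufLen ε (p.classVol j))

/-- The item `x` takes part in a flush with boundary class `b`. -/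
def InTransit (s : State) (b : ℕ) (x : Item) : Prop :=
  x ∈ s.overflow ∨ ∃ i ≥ b, x ∈ (s.region i).payload

/-- A flush with plan `p` is moving the objects of `D`: the rest of the moves will take them to
the goal layout, the regions below the boundary class stay as they are, and everything takes place
in front of the log. -/
structure Flushing (ε : ℝ) (s : State) (p : Plan) (D : Multiset (ℕ × ℕ)) : Prop
    extends Regular ε s where
  proper : ProperObjects D s.maxLen
  objects_eq : liveObjects (s.mainItems ++ s.overflow) = D
  tail_nil : s.tail = []
  buffer_nil : ∀ i, p.boundary ≤ i → (s.region i).buffer = []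
  transit_live : ∀ x, InTransit s p.boundary x → x.kind = .live
  overflow_class : ∀ x ∈ s.overflow, p.boundary ≤ sizeClass x.size
  boundary_le : p.boundary ≤ s.numClasses
  low_end : ∀ i < p.boundary, ∀ x ∈ (s.region i).items, x.addr + x.size ≤ s.regionStart (i + 1)
  low_fixed : ∀ i < p.boundary, ∀ x ∈ (s.region i).items, x.kind = .live →
    ∀ m ∈ p.moves, m.name ≠ x.name
  payCap_le : ∀ i < p.boundary,
    (s.region i).payCap ≤ classLength i D + vol (ofClass i s.bufferItems)
  classVol_eq : ∀ i, p.classVol i = classLength i D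
  totalVol_eq : p.totalVol = totalLength D
  moves_mem : ∀ m ∈ p.moves, (m.name, m.size) ∈ D
  moves_end : ∀ m ∈ p.moves, m.target + m.size ≤ s.logStart
  transit_lands : ∀ x, InTransit s p.boundary x →
    landing p.moves x.name x.addr + x.size ≤ goalStart ε s p (sizeClass x.size + 1)
  item_end : ∀ x ∈ s.mainItems ++ s.overflow, x.addr + x.size ≤ s.logStart
  layout_end : s.layoutEnd ≤ s.logStart
  goal_end : goalStart ε s p (s.numClasses + 1) + bufLen ε p.totalVol ≤ s.logStart

lemma Flushing.mem_objects {ε : ℝ} {s : State} {p : Plan} {D : Multiset (ℕ × ℕ)}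
    (h : Flushing ε s p D) {x : Item} (hx : x ∈ s.mainItems ++ s.overflow)
    (hlive : x.kind = .live) : (x.name, x.size) ∈ D :=
  h.objects_eq ▸ mem_liveObjects hx hlive

lemma Flushing.overflow_class_le {ε : ℝ} {s : State} {p : Plan} {D : Multiset (ℕ × ℕ)}
    (h : Flushing ε s p D) {x : Item} (hx : x ∈ s.overflow) :
    sizeClass x.size ≤ s.numClasses :=
  sizeClass_mono (h.proper.length_mem _
    (h.mem_objects (List.mem_append_right _ hx) (h.transit_live x (.inl hx)))).2

/-! ### The effect of a move -/

/-- The effect of a move on an item. -/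
def Item.moveTo (m : Move) (x : Item) : Item :=
  if x.name = m.name ∧ x.kind = .live then { x with addr := m.target } else x

lemma Item.moveTo_same (m : Move) (x : Item) : (x.moveTo m).name = x.name ∧
    (x.moveTo m).size = x.size ∧ (x.moveTo m).kind = x.kind := by
  unfold Item.moveTo; split <;> simp

lemma Item.size_moveTo (m : Move) (x : Item) : (x.moveTo m).size = x.size :=
  (x.moveTo_same m).2.1

lemma Item.moveTo_of_ne {m : Move} {x : Item} (h : x.kind = .live → m.name ≠ x.name) :
    x.moveTo m = x := by
  unfold Item.moveTo
  rw [if_neg]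
  rintro ⟨hname, hlive⟩
  exact h hlive hname.symm

lemma landing_moveTo {m : Move} {ms : List Move} {x : Item} (h : x.kind = .live) :
    landing ms (x.moveTo m).name (x.moveTo m).addr = landing (m :: ms) x.name x.addr := by
  unfold Item.moveTo landing
  by_cases hname : x.name = m.name
  · simp [h, hname]
  · simp [hname, Ne.symm hname]

lemma relocate_eq (s : State) (m : Move) : s.relocate m = s.mapItems (Item.moveTo m) := rfl

lemma inTransit_mapItems {f : Item → Item} {s : State} {b : ℕ} {x : Item} :
    InTransit (s.mapItems f) b x ↔ ∃ y, InTransit s b y ∧ f y = x := by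
  simp only [InTransit, State.mapItems, List.mem_map]
  grind

lemma Flushing.moveTo_end {ε : ℝ} {s : State} {p : Plan} {D : Multiset (ℕ × ℕ)}
    (h : Flushing ε s p D) {m : Move} (hm : m ∈ p.moves) {x : Item}
    (hx : x ∈ s.mainItems ++ s.overflow) : (x.moveTo m).addr + (x.moveTo m).size ≤ s.logStart := by
  unfold Item.moveTo
  split
  · rename_i hmoved
    have hmem := h.mem_objects hx hmoved.2
    rw [hmoved.1] at hmem
    have hsize := eq_snd_of_nodup h.proper.nodup hmem (h.moves_mem m hm)
    exact hsize ▸ h.moves_end m hm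
  · exact h.item_end x hx

lemma Flushing.relocate {ε : ℝ} {s : State} {b : ℕ} {cv : ℕ → ℕ} {tv : ℕ} {m : Move}
    {ms : List Move} {D : Multiset (ℕ × ℕ)} (h : Flushing ε s ⟨b, cv, tv, m :: ms⟩ D) :
    Flushing ε (s.relocate m) ⟨b, cv, tv, ms⟩ D where
  toRegular := h.toRegular.mapItems (Item.size_moveTo m)
  proper := h.proper
  objects_eq := by
    rw [relocate_eq, mainItems_mapItems, ← h.objects_eq]
    exact (congrArg _ List.map_append.symm).trans (liveObjects_map (Item.moveTo_same m) _)
  tail_nil := List.map_eq_nil_iff.2 h.tail_nil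
  buffer_nil i hi := List.map_eq_nil_iff.2 (h.buffer_nil i hi)
  transit_live x hx := by
    obtain ⟨y, hy, rfl⟩ := inTransit_mapItems.1 hx
    exact (y.moveTo_same m).2.2.trans (h.transit_live y hy)
  overflow_class := by
    refine List.forall_mem_map.2 fun x hx => ?_
    change _ ≤ sizeClass (x.moveTo m).size
    rw [Item.size_moveTo]
    exact h.overflow_class x hx
  boundary_le := h.boundary_le
  low_end i hi := by
    rw [relocate_eq, items_mapItems]
    refine List.forall_mem_map.2 fun x hx => ?_
    rw [Item.moveTo_of_ne fun hlive => h.low_fixed i hi x hx hlive m List.mem_cons_self]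
    exact h.low_end i hi x hx
  low_fixed i hi := by
    rw [relocate_eq, items_mapItems]
    refine List.forall_mem_map.2 fun x hx hlive m' hm' => ?_
    rw [(x.moveTo_same m).1]
    exact h.low_fixed i hi x hx ((x.moveTo_same m).2.2 ▸ hlive) m' (List.mem_cons_of_mem m hm')
  payCap_le i hi := by
    rw [relocate_eq, bufferItems_mapItems, vol_ofClass_map (Item.size_moveTo m)]
    exact h.payCap_le i hi
  classVol_eq := h.classVol_eq
  totalVol_eq := h.totalVol_eq
  moves_mem m' hm' := h.moves_mem m' (List.mem_cons_of_mem m hm')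
  moves_end m' hm' := h.moves_end m' (List.mem_cons_of_mem m hm')
  transit_lands x hx := by
    obtain ⟨y, hy, rfl⟩ := inTransit_mapItems.1 hx
    have hlands := h.transit_lands y hy
    rw [← landing_moveTo (h.transit_live y hy)] at hlands
    exact (y.size_moveTo m).symm ▸ hlands
  item_end := by
    rw [relocate_eq, mainItems_mapItems]
    refine List.forall_mem_append.2 ⟨List.forall_mem_map.2 fun x hx => ?_,
      List.forall_mem_map.2 fun x hx => ?_⟩
    · exact h.moveTo_end List.mem_cons_self (List.mem_append_left _ hx)
    · exact h.moveTo_end List.mem_cons_self (List.mem_append_right _ hx)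
  layout_end := h.layout_end
  goal_end := h.goal_end

/-! ### Installing the new segments -/

lemma bufLen_le {ε : ℝ} (hε : 0 < ε) (v : ℕ) : (bufLen ε v : ℝ) ≤ ε * v :=
  Nat.floor_le (by positivity)

lemma sum_liveObjects_ofClass {b n : ℕ} {l : List Item}
    (h : ∀ x ∈ l, b ≤ sizeClass x.size ∧ sizeClass x.size ≤ n) :
    ∑ i ∈ Finset.range (n + 1), (if b ≤ i then liveObjects (ofClass i l) else 0) =
      liveObjects l := by
  induction l with
  | nil => simp
  | cons x l ih =>
    obtain ⟨hb, hn⟩ := h x List.mem_cons_self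
    have hterm : ∀ i, (if b ≤ i then liveObjects (ofClass i (x :: l)) else 0) =
        (if sizeClass x.size = i then liveObjects [x] else 0) +
          if b ≤ i then liveObjects (ofClass i l) else 0 := by
      intro i
      by_cases hi : sizeClass x.size = i
      · subst hi
        simp [ofClass, hb, ← liveObjects_append]
      · simp [ofClass, hi]
    simp only [hterm, Finset.sum_add_distrib, Finset.sum_ite_eq]
    rw [if_pos (Finset.mem_range.2 (by omega)),
      ih fun y hy => h y (List.mem_cons_of_mem x hy), ← liveObjects_append, List.singleton_append]

lemma region_install_of_le {ε : ℝ} {s : State} {p : Plan} {i : ℕ} (hi : p.boundary ≤ i) :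
    (s.install ε p).region i = ⟨p.classVol i, bufLen ε (p.classVol i),
      (s.region i).payload ++ ofClass i s.overflow, []⟩ := if_pos hi

lemma region_install_of_lt {ε : ℝ} {s : State} {p : Plan} {i : ℕ} (hi : i < p.boundary) :
    (s.install ε p).region i = s.region i := if_neg hi.not_ge

lemma regionStart_install_of_le {ε : ℝ} {s : State} {p : Plan} {i : ℕ} (hi : i ≤ p.boundary) :
    (s.install ε p).regionStart i = s.regionStart i :=
  regionStart_congr fun j hj => by simp [region_install_of_lt (hj.trans_le hi)]

lemma regionStart_install {ε : ℝ} {s : State} {p : Plan} {i : ℕ} (hi : p.boundary ≤ i) :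
    (s.install ε p).regionStart i = goalStart ε s p i := by
  rw [goalStart, ← regionStart_install_of_le (ε := ε) le_rfl, State.regionStart,
    State.regionStart, ← Finset.sum_range_add_sum_Ico _ hi]
  congr 1
  refine Finset.sum_congr rfl fun j hj => ?_
  rw [region_install_of_le (Finset.mem_Ico.1 hj).1]

lemma Flushing.layoutEnd_install {ε : ℝ} {s : State} {p : Plan} {D : Multiset (ℕ × ℕ)}
    (h : Flushing ε s p D) :
    (s.install ε p).layoutEnd = goalStart ε s p (s.numClasses + 1) + bufLen ε p.totalVol :=
  congrArg (· + bufLen ε p.totalVol) (regionStart_install (h.boundary_le.trans (Nat.le_succ _)))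

lemma Flushing.buffer_install {ε : ℝ} {s : State} {p : Plan} {D : Multiset (ℕ × ℕ)}
    (h : Flushing ε s p D) (i : ℕ) :
    ((s.install ε p).region i).buffer = (s.region i).buffer := by
  rcases le_or_gt p.boundary i with hi | hi
  · rw [region_install_of_le hi, h.buffer_nil i hi]
  · rw [region_install_of_lt hi]

lemma Flushing.liveObjects_mainItems_install {ε : ℝ} {s : State} {p : Plan}
    {D : Multiset (ℕ × ℕ)} (h : Flushing ε s p D) :
    liveObjects (s.install ε p).mainItems = D := by
  have hitems : ∀ i, liveObjects ((s.install ε p).region i).items =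
      liveObjects (s.region i).items +
        if p.boundary ≤ i then liveObjects (ofClass i s.overflow) else 0 := by
    intro i
    rcases le_or_gt p.boundary i with hi | hi
    · simp [region_install_of_le hi, Region.items, h.buffer_nil i hi, hi]
    · simp [region_install_of_lt hi, hi.not_ge]
  rw [liveObjects_mainItems, ← h.objects_eq, liveObjects_append, liveObjects_mainItems,
    h.tail_nil, ← sum_liveObjects_ofClass (b := p.boundary) (n := s.numClasses)
      fun x hx => ⟨h.overflow_class x hx, h.overflow_class_le hx⟩]
  simp only [hitems, Finset.sum_add_distrib]
  exact (add_zero _).trans (congrArg (· + _) (add_zero _).symm)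

lemma Flushing.regular_install {ε : ℝ} {s : State} {p : Plan} {D : Multiset (ℕ × ℕ)}
    (hε : 0 < ε) (h : Flushing ε s p D) : Regular ε (s.install ε p) where
  region_eq_empty i hi := by
    have hi' : s.numClasses < i := hi
    have hoverflow : ofClass i s.overflow = [] :=
      ofClass_eq_nil fun x hx => ((h.overflow_class_le hx).trans_lt hi').ne
    have hvol : p.classVol i = 0 := by
      rw [h.classVol_eq]
      exact classLength_eq_zero fun q hq =>
        ((sizeClass_mono (h.proper.length_mem q hq).2).trans_lt hi').ne
    rw [region_install_of_le (h.boundary_le.trans hi'.le), hvol, hoverflow,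
      h.region_eq_empty i hi']
    simp [bufLen]
  payload_class i := by
    rcases le_or_gt p.boundary i with hi | hi
    · rw [region_install_of_le hi]
      exact List.forall_mem_append.2 ⟨h.payload_class i, fun x hx => (mem_ofClass.1 hx).2⟩
    · rw [region_install_of_lt hi]
      exact h.payload_class i
  buffer_class i := by
    rw [h.buffer_install]
    exact h.buffer_class i
  bufCap_le i := by
    rcases le_or_gt p.boundary i with hi | hi
    · rw [region_install_of_le hi]
      exact bufLen_le hε _
    · rw [region_install_of_lt hi]
      exact h.bufCap_le i
  buffer_vol i := by
    rcases le_or_gt p.boundary i with hi | hi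
    · simp [region_install_of_le hi]
    · rw [region_install_of_lt hi]
      exact h.buffer_vol i

lemma Flushing.budget_install {ε : ℝ} {s : State} {p : Plan} {D : Multiset (ℕ × ℕ)}
    (hε : 0 < ε) (h : Flushing ε s p D) : Budget ε (s.install ε p) D where
  payCap_le i := by
    rcases le_or_gt p.boundary i with hi | hi
    · rw [region_install_of_le hi, h.classVol_eq]
      exact Nat.le_add_right _ _
    · have hbuffers : (s.install ε p).bufferItems = s.bufferItems := by
        simp only [State.bufferItems, h.buffer_install, h.tail_nil]
        rfl
      rw [hbuffers, region_install_of_lt hi]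
      exact h.payCap_le i hi
  tailCap_le := by
    refine (bufLen_le hε _).trans ?_
    rw [h.totalVol_eq]
    gcongr
    exact Nat.le_add_right _ _

lemma Flushing.install {ε : ℝ} {s : State} {p : Plan} {D : Multiset (ℕ × ℕ)} (hε : 0 < ε)
    (h : Flushing ε s p D) (hdone : p.moves = []) : Stored ε 0 (s.install ε p) D where
  toRegular := h.regular_install hε
  proper := h.proper
  objects_eq := h.liveObjects_mainItems_install
  item_end i := by
    rcases le_or_gt p.boundary i with hi | hi
    · have hlands : ∀ x, InTransit s p.boundary x → sizeClass x.size = i →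
          x.addr + x.size ≤ goalStart ε s p (i + 1) := by
        rintro x hx rfl
        simpa [hdone, landing] using h.transit_lands x hx
      rw [regionStart_install (by omega), region_install_of_le hi, Region.items, List.append_nil]
      refine List.forall_mem_append.2 ⟨fun x hx => ?_, fun x hx => ?_⟩
      · exact hlands x (.inr ⟨i, hi, hx⟩) (h.payload_class i x hx)
      · exact hlands x (.inl (mem_ofClass.1 hx).1) (mem_ofClass.1 hx).2
    · rw [regionStart_install_of_le hi, region_install_of_lt hi]
      exact h.low_end i hi
  tail_end := by simp [State.install]
  tail_vol := Nat.zero_le _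

/-! ### The moves of a flush -/

lemma totalLength_mono {M N : Multiset (ℕ × ℕ)} (h : M ≤ N) : totalLength M ≤ totalLength N := by
  obtain ⟨K, rfl⟩ := Multiset.le_iff_exists_add.1 h
  simp

lemma classLength_mono {M N : Multiset (ℕ × ℕ)} (h : M ≤ N) (i : ℕ) :
    classLength i M ≤ classLength i N := by
  obtain ⟨K, rfl⟩ := Multiset.le_iff_exists_add.1 h
  simp

/-- The live objects in the payload segments of the classes from `b` on. -/
def State.flushedPayload (s : State) (b : ℕ) : List Item :=
  (s.classesFrom b).flatMap fun i => live (s.region i).payload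

/-- The objects that a flush with boundary class `b` moves. -/
def State.flushed (s : State) (b : ℕ) : List Item := s.flushedPayload b ++ s.buffered b

/-- The moves that bring the objects of a flush to the temporary working space. -/
noncomputable def State.stagingMoves (ε : ℝ) (s : State) (b ins : ℕ) : List Move :=
  layFrom (s.pivot ε b ins) (s.buffered b) ++
    (layFrom (s.pivot ε b ins - vol (s.flushedPayload b)) (s.flushedPayload b)).reverse

/-- The moves that bring the objects of a flush to their final places. -/
noncomputable def State.placingMoves (ε : ℝ) (s : State) (b : ℕ) : List Move :=
  (s.classesFrom b).flatMap (fun i =>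
    layFrom (s.newStart ε b i) (live (s.region i).payload)) ++
  (s.classesFrom b).flatMap (fun i =>
    layFrom (s.newStart ε b i + vol (live (s.region i).payload)) (ofClass i (s.buffered b)))

lemma flushMoves_eq (ε : ℝ) (s : State) (b ins : ℕ) :
    s.flushMoves ε b ins = s.stagingMoves ε b ins ++ s.placingMoves ε b := by
  simp only [State.flushMoves, State.stagingMoves, State.placingMoves, State.flushedPayload,
    List.append_assoc]

lemma mem_classesFrom {s : State} {b i : ℕ} : i ∈ s.classesFrom b ↔ b ≤ i ∧ i ≤ s.numClasses := by
  simp only [State.classesFrom, List.mem_range'_1]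
  omega

lemma sum_map_classesFrom {α : Type*} [AddCommMonoid α] (s : State) (b : ℕ) (f : ℕ → α) :
    ((s.classesFrom b).map f).sum = ∑ i ∈ Finset.Ico b (s.numClasses + 1), f i := rfl

lemma flushedBufs_eq (s : State) (b : ℕ) : s.flushedBufs b =
    ∑ i ∈ Finset.Ico b (s.numClasses + 1), (s.region i).bufCap + s.tailCap :=
  congrArg (· + s.tailCap) (sum_map_classesFrom s b _)

lemma mem_buffered {s : State} {b : ℕ} {x : Item} : x ∈ s.buffered b ↔
    ((∃ i, b ≤ i ∧ i ≤ s.numClasses ∧ x ∈ (s.region i).buffer) ∨ x ∈ s.tail) ∧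
      x.kind = .live := by
  simp only [State.buffered, List.mem_append, List.mem_flatMap, mem_classesFrom, mem_live]
  grind

lemma mem_flushedPayload {s : State} {b : ℕ} {x : Item} : x ∈ s.flushedPayload b ↔
    (∃ i, b ≤ i ∧ i ≤ s.numClasses ∧ x ∈ (s.region i).payload) ∧ x.kind = .live := by
  simp only [State.flushedPayload, List.mem_flatMap, mem_classesFrom, mem_live]
  grind

lemma live_of_mem_flushed {s : State} {b : ℕ} {x : Item} (hx : x ∈ s.flushed b) :
    x.kind = .live :=
  (List.mem_append.1 hx).elim (fun hx => (mem_flushedPayload.1 hx).2)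
    fun hx => (mem_buffered.1 hx).2

lemma mem_mainItems_of_mem_flushed {s : State} {b : ℕ} {x : Item} (hx : x ∈ s.flushed b) :
    x ∈ s.mainItems := by
  rw [mem_mainItems]
  rcases List.mem_append.1 hx with hx | hx
  · obtain ⟨⟨i, -, hi, hx⟩, -⟩ := mem_flushedPayload.1 hx
    exact .inl ⟨i, hi, List.mem_append_left _ hx⟩
  · obtain ⟨⟨i, -, hi, hx⟩ | hx, -⟩ := mem_buffered.1 hx
    exacts [.inl ⟨i, hi, List.mem_append_right _ hx⟩, .inr hx]

lemma le_sizeClass_of_mem_buffered {s : State} {b : ℕ} (hb : s.Admissible b) {x : Item}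
    (hx : x ∈ s.buffered b) : b ≤ sizeClass x.size := by
  obtain ⟨⟨i, hi, hi', hx⟩ | hx, -⟩ := mem_buffered.1 hx
  exacts [hb.2 i (List.mem_range.2 (Nat.lt_succ_of_le hi')) hi x hx, hb.1 x hx]

lemma Regular.le_sizeClass_of_mem_flushed {ε : ℝ} {s : State} (h : Regular ε s) {b : ℕ}
    (hb : s.Admissible b) {x : Item} (hx : x ∈ s.flushed b) : b ≤ sizeClass x.size := by
  rcases List.mem_append.1 hx with hx | hx
  · obtain ⟨⟨i, hi, -, hx⟩, -⟩ := mem_flushedPayload.1 hx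
    exact hi.trans_eq (h.payload_class i x hx).symm
  · exact le_sizeClass_of_mem_buffered hb hx

lemma liveObjects_buffered (s : State) (b : ℕ) : liveObjects (s.buffered b) =
    ∑ i ∈ Finset.Ico b (s.numClasses + 1), liveObjects (s.region i).buffer +
      liveObjects s.tail := by
  rw [State.buffered, liveObjects_append, liveObjects_flatMap, sum_map_classesFrom]
  simp only [liveObjects_live]

lemma liveObjects_flushedPayload (s : State) (b : ℕ) : liveObjects (s.flushedPayload b) =
    ∑ i ∈ Finset.Ico b (s.numClasses + 1), liveObjects (s.region i).payload := by
  rw [State.flushedPayload, liveObjects_flatMap, sum_map_classesFrom]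
  simp only [liveObjects_live]

lemma liveObjects_flushed_le (s : State) (b : ℕ) :
    liveObjects (s.flushed b) ≤ liveObjects s.mainItems := by
  rw [State.flushed, liveObjects_append, liveObjects_flushedPayload, liveObjects_buffered,
    ← add_assoc, ← Finset.sum_add_distrib, liveObjects_mainItems]
  simp only [Region.items, liveObjects_append]
  gcongr
  exact fun i hi => Finset.mem_range.2 (Finset.mem_Ico.1 hi).2

section FlushMoves

variable {ε : ℝ} {ex : ℕ} {s : State} {D : Multiset (ℕ × ℕ)}

lemma Stored.classVol_eq (h : Stored ε ex s D) (i : ℕ) : s.classVol i = classLength i D := by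
  rw [State.classVol, vol_ofClass_live_eq, h.objects_eq]

lemma Stored.totalVol_eq (h : Stored ε ex s D) : s.totalVol = totalLength D := by
  rw [State.totalVol, vol_live_eq, h.objects_eq]

lemma Stored.mem_objects_of_mem_flushed (h : Stored ε ex s D) {b : ℕ} {x : Item}
    (hx : x ∈ s.flushed b) : (x.name, x.size) ∈ D :=
  h.mem_objects (mem_mainItems_of_mem_flushed hx) (live_of_mem_flushed hx)

lemma Stored.vol_flushed_le (h : Stored ε ex s D) (b : ℕ) : vol (s.flushed b) ≤ totalLength D := by
  rw [← live_eq_self fun x hx => live_of_mem_flushed hx, vol_live_eq, ← h.objects_eq]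
  exact totalLength_mono (liveObjects_flushed_le s b)

lemma Stored.vol_class_le (h : Stored ε ex s D) {b i : ℕ} (hi : i ∈ s.classesFrom b) :
    vol (live (s.region i).payload) + vol (ofClass i (s.buffered b)) ≤ s.classVol i := by
  have hpayload : ofClass i (live (s.region i).payload) = live (s.region i).payload :=
    ofClass_eq_self fun x hx => h.payload_class i x (mem_live.1 hx).1
  have hbuffered : live (s.buffered b) = s.buffered b :=
    live_eq_self fun x hx => (mem_buffered.1 hx).2
  have hmem : i ∈ Finset.Ico b (s.numClasses + 1) := by
    simpa [Nat.lt_succ_iff] using mem_classesFrom.1 hi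
  rw [← hpayload, ← hbuffered, vol_ofClass_live_eq, vol_ofClass_live_eq, ← classLength_add,
    State.classVol, vol_ofClass_live_eq]
  refine classLength_mono (le_trans ?_ (liveObjects_flushed_le s b)) i
  rw [State.flushed, liveObjects_append, liveObjects_flushedPayload]
  gcongr
  exact Finset.single_le_sum (f := fun i => liveObjects (s.region i).payload)
    (fun _ _ => zero_le) hmem

lemma newStart_mono (ε : ℝ) (s : State) (b : ℕ) {i j : ℕ} (h : i ≤ j) :
    s.newStart ε b i ≤ s.newStart ε b j := by
  unfold State.newStart
  gcongr

lemma newStart_succ (ε : ℝ) (s : State) {b i : ℕ} (h : b ≤ i) : s.newStart ε b (i + 1) =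
    s.newStart ε b i + (s.classVol i + bufLen ε (s.classVol i)) := by
  rw [State.newStart, State.newStart, Finset.sum_Ico_succ_top h, add_assoc]

lemma Stored.vol_flushedPayload_le_newEnd (h : Stored ε ex s D) (b : ℕ) :
    vol (s.flushedPayload b) ≤ s.newEnd ε b := by
  have hsum : vol (s.flushedPayload b) ≤ ∑ i ∈ Finset.Ico b (s.numClasses + 1),
      (s.classVol i + bufLen ε (s.classVol i)) := by
    rw [State.flushedPayload, vol_flatMap, sum_map_classesFrom]
    refine Finset.sum_le_sum fun i hi => ?_
    have hvol := h.vol_class_le (mem_classesFrom.2 (by simpa [Nat.lt_succ_iff] using hi))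
    omega
  rw [State.newEnd, State.newStart]
  omega

lemma newEnd_le_pivot {b ins : ℕ} (hins : ins ≤ s.maxLen) :
    s.newEnd ε b ≤ s.pivot ε b ins := by
  have hmax := le_max_right (s.tailStart + vol s.tail - ins) (s.newEnd ε b - ins)
  rw [State.pivot]
  omega

lemma layoutEnd_add_le_pivot {b ins : ℕ} (hins : ins ≤ s.maxLen) (htail : ins ≤ vol s.tail) :
    s.layoutEnd + ins ≤ s.pivot ε b ins := by
  have hmax := le_max_left (s.tailStart + vol s.tail - ins) (s.newEnd ε b - ins)
  rw [State.pivot, flushedBufs_eq, State.layoutEnd]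
  omega

lemma exists_of_mem_flushMoves {b ins : ℕ} {m : Move} (hm : m ∈ s.flushMoves ε b ins) :
    ∃ x ∈ s.flushed b, m.name = x.name ∧ m.size = x.size := by
  simp only [flushMoves_eq, State.stagingMoves, State.placingMoves, List.mem_append,
    List.mem_reverse, List.mem_flatMap] at hm
  rcases hm with (hm | hm) | ⟨i, hi, hm⟩ | ⟨i, -, hm⟩ <;>
    obtain ⟨x, hx, hname, hsize, -⟩ := of_mem_layFrom hm <;>
    refine ⟨x, ?_, hname, hsize⟩
  · exact List.mem_append_right _ hx
  · exact List.mem_append_left _ hx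
  · exact List.mem_append_left _ (List.mem_flatMap.2 ⟨i, hi, hx⟩)
  · exact List.mem_append_right _ (mem_ofClass.1 hx).1

lemma Stored.target_le_of_mem_placingMoves (h : Stored ε ex s D) {b : ℕ} {m : Move}
    (hm : m ∈ s.placingMoves ε b) :
    m.target + m.size ≤ s.newStart ε b (sizeClass m.size + 1) := by
  rcases List.mem_append.1 hm with hm | hm <;>
    obtain ⟨i, hi, hm⟩ := List.mem_flatMap.1 hm <;>
    obtain ⟨x, hx, -, hsize, hend⟩ := of_mem_layFrom hm <;>
    have hvol := h.vol_class_le hi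
  · rw [hsize, h.payload_class i x (mem_live.1 hx).1, newStart_succ ε s (mem_classesFrom.1 hi).1]
    omega
  · rw [hsize, (mem_ofClass.1 hx).2, newStart_succ ε s (mem_classesFrom.1 hi).1]
    omega

lemma Stored.target_le_of_mem_flushMoves (h : Stored ε ex s D) {b ins : ℕ}
    (hins : ins ≤ s.maxLen) {m : Move} (hm : m ∈ s.flushMoves ε b ins) :
    m.target + m.size ≤ s.pivot ε b ins + vol (s.buffered b) := by
  have hpivot : s.newEnd ε b ≤ s.pivot ε b ins := newEnd_le_pivot hins
  obtain ⟨x, hx, -, hxsize⟩ := exists_of_mem_flushMoves hm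
  rw [flushMoves_eq] at hm
  rcases List.mem_append.1 hm with hm | hm
  · rcases List.mem_append.1 hm with hm | hm
    · obtain ⟨-, -, -, -, hend⟩ := of_mem_layFrom hm
      exact hend
    · obtain ⟨-, -, -, -, hend⟩ := of_mem_layFrom (List.mem_reverse.1 hm)
      have hpayload := h.vol_flushedPayload_le_newEnd b
      omega
  · have hend := h.target_le_of_mem_placingMoves hm
    have hclass : sizeClass m.size ≤ s.numClasses :=
      hxsize ▸ sizeClass_mono (h.proper.length_mem _ (h.mem_objects_of_mem_flushed hx)).2
    have hmono := newStart_mono ε s b (Nat.succ_le_succ hclass)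
    rw [State.newEnd] at hpivot
    simp only [Nat.succ_eq_add_one] at hmono
    omega

lemma Stored.exists_mem_placingMoves (h : Stored ε ex s D) {b : ℕ} (hb : s.Admissible b)
    {x : Item} (hx : x ∈ s.flushed b) : ∃ m ∈ s.placingMoves ε b, m.name = x.name := by
  rcases List.mem_append.1 hx with hx' | hx'
  · obtain ⟨i, hi, hx'⟩ := List.mem_flatMap.1 hx'
    obtain ⟨m, hm, hname⟩ := exists_mem_layFrom (s.newStart ε b i) hx'
    exact ⟨m, List.mem_append_left _ (List.mem_flatMap.2 ⟨i, hi, hm⟩), hname⟩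
  · obtain ⟨m, hm, hname⟩ := exists_mem_layFrom (s.newStart ε b (sizeClass x.size) +
      vol (live (s.region (sizeClass x.size)).payload)) (mem_ofClass.2 ⟨hx', rfl⟩)
    refine ⟨m, List.mem_append_right _ (List.mem_flatMap.2 ⟨_, mem_classesFrom.2 ⟨?_, ?_⟩, hm⟩),
      hname⟩
    · exact le_sizeClass_of_mem_buffered hb hx'
    · exact sizeClass_mono (h.proper.length_mem _ (h.mem_objects_of_mem_flushed hx)).2

lemma Stored.landing_flushMoves_le (h : Stored ε ex s D) {b : ℕ} (hb : s.Admissible b)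
    (ins a : ℕ) {x : Item} (hx : x ∈ s.flushed b) :
    landing (s.flushMoves ε b ins) x.name a + x.size ≤
      s.newStart ε b (sizeClass x.size + 1) := by
  rw [flushMoves_eq]
  refine landing_append_le (h.exists_mem_placingMoves hb hx) fun m hm hname => ?_
  have hm' : m ∈ s.flushMoves ε b ins := flushMoves_eq ε s b ins ▸ List.mem_append_right _ hm
  obtain ⟨y, hy, hyname, hysize⟩ := exists_of_mem_flushMoves hm'
  have hymem := h.mem_objects_of_mem_flushed hy
  rw [← hyname, ← hysize, hname] at hymem
  have hsize := eq_snd_of_nodup h.proper.nodup hymem (h.mem_objects_of_mem_flushed hx)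
  exact hsize ▸ h.target_le_of_mem_placingMoves hm

lemma Stored.moveVol_flushMoves_le (h : Stored ε ex s D) (b ins : ℕ) :
    moveVol (s.flushMoves ε b ins) ≤ 2 * totalLength D := by
  have hflushed := h.vol_flushed_le b
  have hstaging : moveVol (s.stagingMoves ε b ins) = vol (s.flushed b) := by
    simp [State.stagingMoves, State.flushed, add_comm]
  have hclasses : ((s.classesFrom b).map fun i => vol (ofClass i (s.buffered b))).sum ≤
      vol (s.buffered b) := by
    rw [sum_map_classesFrom]
    exact sum_vol_ofClass_le _ _
  have hplacing : moveVol (s.placingMoves ε b) ≤ vol (s.flushed b) := by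
    simp only [State.placingMoves, moveVol_append, moveVol_flatMap, moveVol_layFrom,
      State.flushed, vol_append, State.flushedPayload, vol_flatMap]
    exact Nat.add_le_add_left hclasses _
  rw [flushMoves_eq, moveVol_append]
  omega

end FlushMoves

/-! ### The start of a flush -/

/-- The plan with which a flush starts. -/
noncomputable def State.flushPlan (ε : ℝ) (s : State) (w : ℕ) (isInsert : Bool) : Plan :=
  ⟨s.boundary w, s.classVol, s.totalVol,
    s.flushMoves ε (s.boundary w) (if isInsert then w else 0)⟩

lemma admissible_boundary (s : State) (w : ℕ) : s.Admissible (s.boundary w) :=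
  Nat.findGreatest_spec (P := s.Admissible) (Nat.zero_le _) ⟨by simp, by simp⟩

lemma boundary_le_sizeClass (s : State) (w : ℕ) : s.boundary w ≤ sizeClass w :=
  Nat.findGreatest_le _

section StartFlush

variable {ε : ℝ} {s : State} {w : ℕ} {isInsert : Bool}

lemma region_startFlush_of_le {i : ℕ} (hi : s.boundary w ≤ i) :
    (s.startFlush ε w isInsert).region i =
      { s.region i with payload := live (s.region i).payload, buffer := [] } := if_pos hi

lemma region_startFlush_of_lt {i : ℕ} (hi : i < s.boundary w) :
    (s.startFlush ε w isInsert).region i = s.region i := if_neg hi.not_ge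

lemma payCap_startFlush (i : ℕ) :
    ((s.startFlush ε w isInsert).region i).payCap = (s.region i).payCap := by
  simp only [State.startFlush]; split <;> rfl

lemma bufCap_startFlush (i : ℕ) :
    ((s.startFlush ε w isInsert).region i).bufCap = (s.region i).bufCap := by
  simp only [State.startFlush]; split <;> rfl

lemma payload_startFlush_subset (i : ℕ) :
    ((s.startFlush ε w isInsert).region i).payload ⊆ (s.region i).payload := by
  simp only [State.startFlush]
  split
  · exact fun x hx => (mem_live.1 hx).1
  · exact List.Subset.refl _

lemma buffer_startFlush_subset (i : ℕ) :
    ((s.startFlush ε w isInsert).region i).buffer ⊆ (s.region i).buffer := by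
  simp only [State.startFlush]; split <;> simp

lemma items_startFlush_subset (i : ℕ) :
    ((s.startFlush ε w isInsert).region i).items ⊆ (s.region i).items :=
  fun _ hx => List.mem_append.2 ((List.mem_append.1 hx).imp
    (fun hx => payload_startFlush_subset i hx) fun hx => buffer_startFlush_subset i hx)

lemma regionStart_startFlush (i : ℕ) :
    (s.startFlush ε w isInsert).regionStart i = s.regionStart i :=
  regionStart_congr fun j _ => ⟨payCap_startFlush j, bufCap_startFlush j⟩

lemma goalStart_startFlush (i : ℕ) :
    goalStart ε (s.startFlush ε w isInsert) (s.flushPlan ε w isInsert) i =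
      s.newStart ε (s.boundary w) i := by
  rw [goalStart, regionStart_startFlush]
  rfl

lemma layoutEnd_startFlush : (s.startFlush ε w isInsert).layoutEnd = s.layoutEnd :=
  congrArg (· + s.tailCap) (regionStart_startFlush _)

lemma mem_mainItems_of_mem_startFlush {x : Item}
    (hx : x ∈ (s.startFlush ε w isInsert).mainItems ++ (s.startFlush ε w isInsert).overflow) :
    x ∈ s.mainItems := by
  rcases List.mem_append.1 hx with hx | hx
  · obtain ⟨i, hi, hx⟩ | hx := mem_mainItems.1 hx
    · exact mem_mainItems.2 (.inl ⟨i, hi, items_startFlush_subset i hx⟩)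
    · exact absurd hx List.not_mem_nil
  · exact mem_mainItems_of_mem_flushed (List.mem_append_right _ hx)

lemma Regular.mem_flushed_of_inTransit (h : Regular ε s) {x : Item}
    (hx : InTransit (s.startFlush ε w isInsert) (s.boundary w) x) :
    x ∈ s.flushed (s.boundary w) := by
  obtain hx | ⟨i, hi, hx⟩ := hx
  · exact List.mem_append_right _ hx
  · have hle := h.le_numClasses (List.mem_append_left _ (payload_startFlush_subset i hx))
    rw [region_startFlush_of_le hi] at hx
    exact List.mem_append_left _ (mem_flushedPayload.2
      ⟨⟨i, hi, hle, (mem_live.1 hx).1⟩, (mem_live.1 hx).2⟩)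

lemma Regular.startFlush (h : Regular ε s) : Regular ε (s.startFlush ε w isInsert) where
  region_eq_empty i hi := by simp [State.startFlush, h.region_eq_empty i hi]
  payload_class i x hx := h.payload_class i x (payload_startFlush_subset i hx)
  buffer_class i x hx := h.buffer_class i x (buffer_startFlush_subset i hx)
  bufCap_le i := by
    rw [bufCap_startFlush, payCap_startFlush]
    exact h.bufCap_le i
  buffer_vol i := by
    rw [bufCap_startFlush]
    rcases le_or_gt (s.boundary w) i with hi | hi
    · simp [region_startFlush_of_le hi]
    · rw [region_startFlush_of_lt hi]
      exact h.buffer_vol i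

lemma liveObjects_startFlush (hb : s.boundary w ≤ s.numClasses) :
    liveObjects ((s.startFlush ε w isInsert).mainItems ++
      (s.startFlush ε w isInsert).overflow) = liveObjects s.mainItems := by
  have hlow : ∀ i ∈ Finset.range (s.boundary w),
      liveObjects ((s.startFlush ε w isInsert).region i).items =
        liveObjects (s.region i).items := by
    intro i hi
    rw [region_startFlush_of_lt (Finset.mem_range.1 hi)]
  have hhigh : ∀ i ∈ Finset.Ico (s.boundary w) (s.numClasses + 1),
      liveObjects ((s.startFlush ε w isInsert).region i).items =
        liveObjects (s.region i).payload := by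
    intro i hi
    simp [region_startFlush_of_le (Finset.mem_Ico.1 hi).1, Region.items]
  have hsplit : ∀ f : ℕ → Multiset (ℕ × ℕ), ∑ i ∈ Finset.range (s.numClasses + 1), f i =
      ∑ i ∈ Finset.range (s.boundary w), f i +
        ∑ i ∈ Finset.Ico (s.boundary w) (s.numClasses + 1), f i :=
    fun f => (Finset.sum_range_add_sum_Ico f (by omega)).symm
  change liveObjects (_ ++ s.buffered (s.boundary w)) = _
  rw [liveObjects_append, liveObjects_buffered, liveObjects_mainItems, liveObjects_mainItems,
    hsplit fun i => liveObjects (s.region i).items]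
  change ∑ i ∈ Finset.range (s.numClasses + 1), _ + 0 + _ = _
  rw [hsplit, Finset.sum_congr rfl hlow, Finset.sum_congr rfl hhigh]
  simp only [Region.items, liveObjects_append, Finset.sum_add_distrib]
  abel

lemma ofClass_bufferItems_startFlush {i : ℕ} (hi : i < s.boundary w) :
    ofClass i (s.startFlush ε w isInsert).bufferItems = ofClass i s.bufferItems := by
  have hadm := admissible_boundary s w
  have htail : ofClass i s.tail = [] :=
    ofClass_eq_nil fun x hx => (hi.trans_le (hadm.1 x hx)).ne'
  simp only [State.bufferItems, ofClass_append, htail]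
  congr 1
  simp only [ofClass, List.filter_flatMap]
  refine List.flatMap_congr fun j hj => ?_
  rcases le_or_gt (s.boundary w) j with hj' | hj'
  · rw [region_startFlush_of_le hj']
    exact (ofClass_eq_nil fun x hx => (hi.trans_le (hadm.2 j hj hj' x hx)).ne').symm
  · rw [region_startFlush_of_lt hj']

lemma Regular.sizeClass_le (h : Regular ε s) {i : ℕ} {x : Item} (hx : x ∈ (s.region i).items) :
    sizeClass x.size ≤ i :=
  (List.mem_append.1 hx).elim (fun hx => (h.payload_class i x hx).le) (h.buffer_class i x)

variable {D : Multiset (ℕ × ℕ)}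

lemma Stored.name_ne_of_mem_flushMoves {ex : ℕ} (h : Stored ε ex s D) {b ins i : ℕ}
    (hb : s.Admissible b) (hi : i < b) {x : Item} (hx : x ∈ (s.region i).items)
    (hlive : x.kind = .live) {m : Move} (hm : m ∈ s.flushMoves ε b ins) : m.name ≠ x.name := by
  intro hname
  obtain ⟨y, hy, hyname, -⟩ := exists_of_mem_flushMoves hm
  have hymem := h.mem_objects_of_mem_flushed hy
  rw [← hyname, hname] at hymem
  have hsize := eq_snd_of_nodup h.proper.nodup hymem
    (h.mem_objects (h.toRegular.mem_mainItems hx) hlive)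
  have hle := h.toRegular.le_sizeClass_of_mem_flushed hb hy
  rw [hsize] at hle
  exact absurd (hle.trans (h.toRegular.sizeClass_le hx)) hi.not_ge

lemma Stored.startFlush (h : Stored ε (if isInsert then w else 0) s D) (hw : w ≤ s.maxLen)
    (htail : (if isInsert then w else 0) ≤ vol s.tail)
    (hpay : ∀ i < sizeClass w,
      (s.region i).payCap ≤ classLength i D + vol (ofClass i s.bufferItems)) :
    Flushing ε (s.startFlush ε w isInsert) (s.flushPlan ε w isInsert) D := by
  have hadm := admissible_boundary s w
  have hins : (if isInsert then w else 0) ≤ s.maxLen := by split <;> omega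
  have hle : s.boundary w ≤ s.numClasses :=
    (boundary_le_sizeClass s w).trans (sizeClass_mono hw)
  have hlayout := layoutEnd_add_le_pivot (ε := ε) (b := s.boundary w) hins htail
  exact
  { h.toRegular.startFlush with
    proper := h.proper
    objects_eq := (liveObjects_startFlush hle).trans h.objects_eq
    tail_nil := rfl
    buffer_nil := fun i hi => by rw [region_startFlush_of_le hi]
    transit_live := fun x hx => live_of_mem_flushed (h.toRegular.mem_flushed_of_inTransit hx)
    overflow_class := fun x hx => le_sizeClass_of_mem_buffered hadm hx
    boundary_le := hle
    low_end := fun i _ x hx => by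
      rw [regionStart_startFlush]
      exact h.item_end i x (items_startFlush_subset i hx)
    low_fixed := fun i hi x hx hlive m hm =>
      h.name_ne_of_mem_flushMoves hadm hi (items_startFlush_subset i hx) hlive hm
    payCap_le := fun i hi => by
      rw [payCap_startFlush, ofClass_bufferItems_startFlush hi]
      exact hpay i (hi.trans_le (boundary_le_sizeClass s w))
    classVol_eq := h.classVol_eq
    totalVol_eq := h.totalVol_eq
    moves_mem := fun m hm => by
      obtain ⟨x, hx, hname, hsize⟩ := exists_of_mem_flushMoves hm
      exact hname ▸ hsize ▸ h.mem_objects_of_mem_flushed hx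
    moves_end := fun m hm => h.target_le_of_mem_flushMoves hins hm
    transit_lands := fun x hx => by
      rw [goalStart_startFlush]
      exact h.landing_flushMoves_le hadm _ _ (h.toRegular.mem_flushed_of_inTransit hx)
    item_end := fun x hx => (h.mainItem_end (mem_mainItems_of_mem_startFlush hx)).trans
      (hlayout.trans (Nat.le_add_right _ _))
    layout_end := layoutEnd_startFlush.trans_le
      ((Nat.le_add_right _ _).trans (hlayout.trans (Nat.le_add_right _ _)))
    goal_end := by
      rw [goalStart_startFlush]
      exact (newEnd_le_pivot hins).trans (Nat.le_add_right _ _) }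

lemma flushedBufs_le_bufferSpace (s : State) (b : ℕ) : s.flushedBufs b ≤ s.bufferSpace := by
  rw [flushedBufs_eq, State.bufferSpace]
  gcongr
  exact fun i hi => Finset.mem_range.2 (Finset.mem_Ico.1 hi).2

lemma Stored.vol_buffered_le {ex : ℕ} (h : Stored ε ex s D) (b : ℕ) :
    vol (s.buffered b) ≤ s.flushedBufs b + ex := by
  rw [State.buffered, vol_append, vol_flatMap, flushedBufs_eq, sum_map_classesFrom, add_assoc]
  exact Nat.add_le_add (Finset.sum_le_sum fun i _ => (vol_live_le _).trans (h.buffer_vol i))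
    ((vol_live_le _).trans h.tail_vol)

lemma Stored.logStart_le (hε : 0 < ε) (hε' : ε ≤ 1 / 4)
    (h : Stored ε (if isInsert then w else 0) s D)
    (hflush : Flushing ε (s.startFlush ε w isInsert) (s.flushPlan ε w isInsert) D)
    (htail : (if isInsert then w else 0) ≤ vol s.tail) {X : ℕ} (hX : totalLength D ≤ X)
    (hlayout : ((s.layoutEnd + (if isInsert then w else 0) : ℕ) : ℝ) ≤ (1 + 8 * ε) * X)
    (hbuffers : (s.bufferSpace : ℝ) ≤ 4 * ε * X) :
    ((s.startFlush ε w isInsert).logStart : ℝ) ≤ (1 + 16 * ε) * X + s.maxLen := by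
  set b := s.boundary w
  set ins := if isInsert then w else 0
  have hgoal : (s.newEnd ε b : ℝ) ≤ (1 + 8 * ε) * X := by
    have hinstall := (hflush.budget_install hε).layoutEnd_le hε hε' (hflush.regular_install hε)
      (Nat.zero_le _)
    rw [hflush.layoutEnd_install, goalStart_startFlush] at hinstall
    exact hinstall.trans (by gcongr)
  have hmax : ((max (s.layoutEnd + ins) (s.newEnd ε b) : ℕ) : ℝ) ≤ (1 + 8 * ε) * X := by
    rw [Nat.cast_max]
    exact max_le hlayout hgoal
  have hlogStart : (s.startFlush ε w isInsert).logStart ≤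
      max (s.layoutEnd + ins) (s.newEnd ε b) + 2 * s.bufferSpace + s.maxLen := by
    change s.pivot ε b ins + vol (s.buffered b) ≤ _
    have hbuffered := h.vol_buffered_le b
    have hbufs := flushedBufs_le_bufferSpace s b
    have htail_vol := h.tail_vol
    rw [State.pivot, State.layoutEnd]
    omega
  have hcast : ((s.startFlush ε w isInsert).logStart : ℝ) ≤
      (max (s.layoutEnd + ins) (s.newEnd ε b) : ℕ) + 2 * s.bufferSpace + s.maxLen := by
    exact_mod_cast hlogStart
  linarith

end StartFlush

/-! ### Changes that leave the stored items alone -/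

/-- The states `s` and `s'` have the same segments with the same contents; longer objects may have
been inserted in the meantime. -/
structure SameStorage (s s' : State) : Prop where
  region_eq : s'.region = s.region
  tailCap_eq : s'.tailCap = s.tailCap
  tail_eq : s'.tail = s.tail
  overflow_eq : s'.overflow = s.overflow
  maxLen_le : s.maxLen ≤ s'.maxLen

section SameStorage

variable {ε : ℝ} {s s' : State} {D : Multiset (ℕ × ℕ)}

lemma SameStorage.numClasses_le (h : SameStorage s s') : s.numClasses ≤ s'.numClasses :=
  sizeClass_mono h.maxLen_le

lemma SameStorage.regionStart_eq (h : SameStorage s s') (i : ℕ) :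
    s'.regionStart i = s.regionStart i :=
  regionStart_congr fun j _ => by simp [h.region_eq]

lemma SameStorage.layoutEnd_eq (h : SameStorage s s') (hreg : Regular ε s) :
    s'.layoutEnd = s.layoutEnd := by
  rw [State.layoutEnd, State.layoutEnd, h.tailCap_eq, State.tailStart, h.regionStart_eq,
    State.regionStart, ← sum_range_extend h.numClasses_le fun i hi => by
      simp [hreg.region_eq_empty i hi]]
  rfl

lemma SameStorage.mainItems_eq (h : SameStorage s s') (hreg : Regular ε s) :
    s'.mainItems = s.mainItems := by
  rw [State.mainItems, State.mainItems, h.region_eq, h.tail_eq,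
    flatMap_range_extend h.numClasses_le fun i hi => by simp [hreg.region_eq_empty i hi]]

lemma SameStorage.bufferItems_eq (h : SameStorage s s') (hreg : Regular ε s) :
    s'.bufferItems = s.bufferItems := by
  rw [State.bufferItems, State.bufferItems, h.region_eq, h.tail_eq,
    flatMap_range_extend h.numClasses_le fun i hi => by simp [hreg.region_eq_empty i hi]]

lemma Regular.of_sameStorage (h : Regular ε s) (hs : SameStorage s s') : Regular ε s' where
  region_eq_empty i hi := hs.region_eq ▸ h.region_eq_empty i (hs.numClasses_le.trans_lt hi)
  payload_class := hs.region_eq ▸ h.payload_class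
  buffer_class := hs.region_eq ▸ h.buffer_class
  bufCap_le := hs.region_eq ▸ h.bufCap_le
  buffer_vol := hs.region_eq ▸ h.buffer_vol

lemma Stored.of_sameStorage {ex : ℕ} (h : Stored ε ex s D) (hs : SameStorage s s') :
    Stored ε ex s' D where
  toRegular := h.toRegular.of_sameStorage hs
  proper := h.proper.mono hs.maxLen_le
  objects_eq := by rw [hs.mainItems_eq h.toRegular, h.objects_eq]
  item_end i x hx := by
    rw [hs.region_eq] at hx
    rw [hs.regionStart_eq]
    exact h.item_end i x hx
  tail_end := by
    rw [hs.layoutEnd_eq h.toRegular, hs.tail_eq]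
    exact h.tail_end
  tail_vol := by
    rw [hs.tail_eq, hs.tailCap_eq]
    exact h.tail_vol

lemma Budget.of_sameStorage (h : Budget ε s D) (hreg : Regular ε s) (hs : SameStorage s s') :
    Budget ε s' D where
  payCap_le := by
    rw [hs.region_eq, hs.bufferItems_eq hreg]
    exact h.payCap_le
  tailCap_le := by
    rw [hs.tailCap_eq, hs.bufferItems_eq hreg]
    exact h.tailCap_le

lemma goalStart_eq_of_sameStorage (hs : SameStorage s s') (p : Plan) (i : ℕ) :
    goalStart ε s' p i = goalStart ε s p i := by
  rw [goalStart, goalStart, hs.regionStart_eq]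

lemma Flushing.goalStart_eq_of_numClasses_le {p : Plan} (h : Flushing ε s p D) {i : ℕ}
    (hi : s.numClasses < i) :
    goalStart ε s p i = goalStart ε s p (s.numClasses + 1) := by
  rw [goalStart, goalStart]
  congr 1
  refine (Finset.sum_subset (Finset.Ico_subset_Ico_right hi) fun j hj hj' => ?_).symm
  have hvol : p.classVol j = 0 := by
    rw [h.classVol_eq]
    refine classLength_eq_zero fun q hq hclass => ?_
    have hle : sizeClass q.2 ≤ s.numClasses := sizeClass_mono (h.proper.length_mem q hq).2
    simp only [Finset.mem_Ico] at hj hj'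
    omega
  simp [hvol, bufLen]

lemma Flushing.of_sameStorage {p : Plan} (h : Flushing ε s p D) (hs : SameStorage s s')
    (hlog : s'.logStart = s.logStart) : Flushing ε s' p D := by
  have hmain := hs.mainItems_eq h.toRegular
  have htransit : ∀ x, InTransit s' p.boundary x → InTransit s p.boundary x := by
    simp only [InTransit, hs.overflow_eq, hs.region_eq]
    exact fun _ hx => hx
  exact
  { h.toRegular.of_sameStorage hs with
    proper := h.proper.mono hs.maxLen_le
    objects_eq := by rw [hmain, hs.overflow_eq, h.objects_eq]
    tail_nil := hs.tail_eq.trans h.tail_nil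
    buffer_nil := hs.region_eq ▸ h.buffer_nil
    transit_live := fun x hx => h.transit_live x (htransit x hx)
    overflow_class := hs.overflow_eq ▸ h.overflow_class
    boundary_le := h.boundary_le.trans hs.numClasses_le
    low_end := fun i hi x hx => by
      rw [hs.region_eq] at hx
      rw [hs.regionStart_eq]
      exact h.low_end i hi x hx
    low_fixed := hs.region_eq ▸ h.low_fixed
    payCap_le := by
      rw [hs.region_eq, hs.bufferItems_eq h.toRegular]
      exact h.payCap_le
    classVol_eq := h.classVol_eq
    totalVol_eq := h.totalVol_eq
    moves_mem := h.moves_mem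
    moves_end := hlog ▸ h.moves_end
    transit_lands := fun x hx => by
      rw [goalStart_eq_of_sameStorage hs]
      exact h.transit_lands x (htransit x hx)
    item_end := by
      rw [hmain, hs.overflow_eq, hlog]
      exact h.item_end
    layout_end := by
      rw [hs.layoutEnd_eq h.toRegular, hlog]
      exact h.layout_end
    goal_end := by
      rw [goalStart_eq_of_sameStorage hs,
        h.goalStart_eq_of_numClasses_le (Nat.lt_succ_of_le hs.numClasses_le), hlog]
      exact h.goal_end }

end SameStorage

/-! ### The log -/

/-- Carrying out the items of a log in order leads from the active objects `D` to `A`. -/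
def Replays : Directory → List Item → Directory → Prop
  | D, [], A => D = A
  | D, x :: xs, A =>
    if x.kind = .live then
      x.name ∉ D.map Prod.fst ∧ Replays (D.update (.insert x.name x.size)) xs A
    else (x.name, x.size) ∈ D ∧ Replays (D.update (.delete x.name)) xs A

lemma Replays.append_singleton {D A A' : Directory} {l : List Item} {x : Item}
    (h : Replays D l A) (hx : Replays A [x] A') : Replays D (l ++ [x]) A' := by
  induction l generalizing D with
  | nil =>
    obtain rfl : D = A := h
    exact hx
  | cons y l ih =>
    simp only [Replays, List.cons_append] at h ⊢
    split at h
    · exact (if_pos ‹_›).mpr ⟨h.1, ih h.2⟩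
    · exact (if_neg ‹_›).mpr ⟨h.1, ih h.2⟩

/-- The account of a flush that found objects of total length `Vf`, and during which requests of
total length `W` have been put into the log: `rem` is the volume of the steps still to be done, and
`k` the volume of the work still due. In the eager variant, the request that triggered the flush has
paid for the length `pending` of the object it deletes; the factor is `2 / ε` rather than `4 / ε`
because a part of its work may have gone into the previous flush. -/
structure Ledger (ε : ℝ) (eager : Bool) (k : ℕ) (s : State) (Vf W rem : ℕ) : Prop where
  logEnd_eq : s.logEnd = s.logStart + W
  logStart_le : (s.logStart : ℝ) ≤ (1 + 16 * ε) * (Vf + s.pending : ℕ) + s.maxLen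
  startVol_le : Vf ≤ totalLength s.active + W
  work_le : 4 / ε * W + rem ≤ 2 * Vf + W + k
  pending_le : eager = true → 2 / ε * s.pending + rem ≤ 5 * Vf + k
  log_fits : ∀ l x, s.log = l ++ [x] → W ≤ bufLen ε Vf + x.size
  log_end : ∀ x ∈ s.log, x.addr + x.size ≤ s.logEnd
  log_size : ∀ x ∈ s.log, 1 ≤ x.size ∧ x.size ≤ s.maxLen

section Ledger

variable {ε : ℝ} {eager : Bool} {k : ℕ} {s : State} {Vf W rem : ℕ}

lemma Ledger.advance {v : ℕ} {region : ℕ → Region} {tailCap : ℕ} {tail overflow log : List Item}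
    {phase : Phase} (h : Ledger ε eager k s Vf W (v + rem)) (hlog : log <:+ s.log) :
    Ledger ε eager (k - v) { s with region, tailCap, tail, phase, overflow, log } Vf W rem := by
  have hk : (k : ℝ) ≤ (k - v : ℕ) + v := by exact_mod_cast (by omega : k ≤ k - v + v)
  exact
  { logEnd_eq := h.logEnd_eq
    logStart_le := h.logStart_le
    startVol_le := h.startVol_le
    work_le := by
      have hwork := h.work_le
      push_cast at hwork
      linarith
    pending_le := fun he => by
      have hpending := h.pending_le he
      push_cast at hpending
      linarith
    log_fits := fun l x hx => by
      obtain ⟨t, ht⟩ := hlog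
      exact h.log_fits (t ++ l) x (by rw [← ht, show log = l ++ [x] from hx, List.append_assoc])
    log_end := fun x hx => h.log_end x (hlog.subset hx)
    log_size := fun x hx => h.log_size x (hlog.subset hx) }

lemma Ledger.log_le (hε : 0 < ε) (hε' : ε ≤ 1 / 4) (h : Ledger ε eager 0 s Vf W rem) :
    (W : ℝ) ≤ ε * Vf := by
  have hwork : 4 / ε * W ≤ 2 * Vf + W := by
    have hle := h.work_le
    push_cast at hle
    linarith [(Nat.cast_nonneg rem : (0 : ℝ) ≤ rem)]
  rw [div_mul_eq_mul_div, div_le_iff₀ hε] at hwork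
  nlinarith [(Nat.cast_nonneg W : (0 : ℝ) ≤ W)]

lemma le_workVolume (ε : ℝ) (w : ℕ) : 4 / ε * w ≤ workVolume ε w := by
  rw [workVolume, Nat.cast_add_one]
  exact (Nat.lt_floor_add_one _).le

lemma Ledger.pushLog (hε : 0 < ε) (hε' : ε ≤ 1 / 4) (h : Ledger ε eager 0 s Vf W rem)
    {A : Directory} {Δ : ℕ} {x : Item} (hΔ : s.maxLen ≤ Δ)
    (hA : totalLength s.active ≤ totalLength A + x.size) (hx : 1 ≤ x.size ∧ x.size ≤ Δ) :
    Ledger ε eager (workVolume ε x.size) (State.pushLog { s with active := A, maxLen := Δ } x) Vf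
      (W + x.size) (rem + x.size) := by
  have hk := le_workVolume ε x.size
  have hsize : (x.size : ℝ) ≤ workVolume ε x.size := by
    refine le_trans (le_mul_of_one_le_left (by positivity) ?_) hk
    rw [le_div_iff₀ hε]
    linarith
  exact
  { logEnd_eq := by simp only [State.pushLog, h.logEnd_eq, add_assoc]
    logStart_le := h.logStart_le.trans (by simpa [State.pushLog] using hΔ)
    startVol_le := h.startVol_le.trans (by simp only [State.pushLog]; omega)
    work_le := by
      have hwork := h.work_le
      push_cast at hwork ⊢
      linarith
    pending_le := fun he => by
      have hpending := h.pending_le he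
      push_cast at hpending
      simp only [State.pushLog]
      push_cast
      linarith
    log_fits := fun l y hy => by
      obtain ⟨-, hxy⟩ := List.append_inj' hy rfl
      have hW : W ≤ bufLen ε Vf := Nat.le_floor (h.log_le hε hε')
      rw [← List.singleton_inj.1 hxy]
      exact Nat.add_le_add_right hW _
    log_end := List.forall_mem_append.2
      ⟨fun y hy => (h.log_end y hy).trans (Nat.le_add_right _ _), by simp [State.pushLog]⟩
    log_size := List.forall_mem_append.2
      ⟨fun y hy => ⟨(h.log_size y hy).1, (h.log_size y hy).2.trans hΔ⟩,
        List.forall_mem_singleton.2 hx⟩ }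

lemma Ledger.logEnd_le (hε : 0 < ε) (hε' : ε ≤ 1 / 4) (h : Ledger ε eager 0 s Vf W rem) :
    (s.logEnd : ℝ) ≤ (1 + 64 * ε) *
      (if eager then totalLength s.active else totalLength s.active + s.pending : ℕ) +
      s.maxLen := by
  set V := totalLength s.active
  have hW := h.log_le hε hε'
  have hVf : (Vf : ℝ) ≤ V + W := by exact_mod_cast h.startVol_le
  have hlogEnd : (s.logEnd : ℝ) = s.logStart + W := by exact_mod_cast h.logEnd_eq
  have hlogStart := h.logStart_le
  push_cast at hlogStart
  have hεV : 0 ≤ ε * V := by positivity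
  have hεpending : 0 ≤ ε * s.pending := by positivity
  have hεVf : ε * Vf ≤ 2 * (ε * V) := by nlinarith
  cases eager with
  | false =>
    simp only [Bool.false_eq_true, if_false]
    push_cast
    linarith
  | true =>
    simp only [if_true]
    have hpending : 2 * (s.pending : ℝ) ≤ 5 * (ε * Vf) := by
      have hle : 2 / ε * s.pending ≤ 5 * Vf := by
        have hwork := h.pending_le rfl
        push_cast at hwork
        linarith [(Nat.cast_nonneg rem : (0 : ℝ) ≤ rem)]
      rw [div_mul_eq_mul_div, div_le_iff₀ hε] at hle
      linarith
    have hεpending' : ε * s.pending ≤ s.pending / 4 := by nlinarith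
    linarith

end Ledger

/-! ### The invariant -/

/-- While a flush is moving objects according to the plan `p`: the flush found the objects `D`, and
the requests in the log lead from these to the active ones. -/
structure MovingInv (ε : ℝ) (eager : Bool) (k : ℕ) (s : State) (p : Plan) (D : Directory) :
    Prop where
  flushing : Flushing ε s p D
  replays : Replays D s.log s.active
  ledger : Ledger ε eager k s (totalLength D) (vol s.log) (moveVol p.moves + vol s.log)

/-- While the log is moved to the buffers: the objects `D` are stored in the segments, and the rest
of the log leads from these to the active ones.  The flush found objects of total length `Vf`, and
requests of total length `W` have been put into the log. -/
structure DrainInv (ε : ℝ) (eager : Bool) (k : ℕ) (s : State) (D : Directory) (Vf W : ℕ) :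
    Prop where
  stored : Stored ε 0 s D
  budget : Budget ε s D
  replays : Replays D s.log s.active
  overflow_nil : s.overflow = []
  tailCap_eq : s.tailCap = bufLen ε Vf
  tail_log_le : vol s.tail + vol s.log ≤ W
  layoutEnd_le : s.layoutEnd ≤ s.logStart
  ledger : Ledger ε eager k s Vf W (vol s.log)

/-- While no flush is in progress: the active objects are stored in the segments. -/
structure IdleInv (ε : ℝ) (s : State) : Prop where
  stored : Stored ε 0 s s.active
  budget : Budget ε s s.active
  overflow_nil : s.overflow = []
  log_nil : s.log = []

/-- The invariant of the data structure, when work of volume `k` is still due. -/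
def PhaseInv (ε : ℝ) (eager : Bool) (k : ℕ) (s : State) : Prop :=
  match s.phase with
  | .idle => IdleInv ε s
  | .moving p => p.moves ≠ [] ∧ ∃ D, MovingInv ε eager k s p D
  | .draining => s.log ≠ [] ∧ ∃ D Vf W, DrainInv ε eager k s D Vf W

section PhaseInv

variable {ε : ℝ} {eager : Bool} {k : ℕ} {s : State}

lemma phaseInv_idle (hs : s.phase = .idle) : PhaseInv ε eager k s ↔ IdleInv ε s := by
  rw [PhaseInv, hs]

lemma phaseInv_moving {p : Plan} (hs : s.phase = .moving p) :
    PhaseInv ε eager k s ↔ p.moves ≠ [] ∧ ∃ D, MovingInv ε eager k s p D := by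
  rw [PhaseInv, hs]

lemma phaseInv_draining (hs : s.phase = .draining) :
    PhaseInv ε eager k s ↔ s.log ≠ [] ∧ ∃ D Vf W, DrainInv ε eager k s D Vf W := by
  rw [PhaseInv, hs]

lemma DrainInv.finish {D : Directory} {Vf W : ℕ} (hs : s.phase = .draining)
    (h : DrainInv ε eager k s D Vf W) : PhaseInv ε eager k s.finish := by
  unfold State.finish
  split
  · rename_i hl
    have hreplays := h.replays
    rw [hl] at hreplays
    obtain rfl : D = s.active := hreplays
    exact (phaseInv_idle rfl).2
      ⟨h.stored.of_sameStorage ⟨rfl, rfl, rfl, rfl, le_rfl⟩,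
        h.budget.of_sameStorage h.stored.toRegular ⟨rfl, rfl, rfl, rfl, le_rfl⟩,
        h.overflow_nil, hl⟩
  · rename_i hne
    exact (phaseInv_draining hs).2 ⟨hne hs, D, Vf, W, h⟩

lemma MovingInv.install {p : Plan} {D : Directory} (hε : 0 < ε) (h : MovingInv ε eager k s p D)
    (hdone : p.moves = []) :
    DrainInv ε eager k (s.install ε p) D (totalLength D) (vol s.log) where
  stored := h.flushing.install hε hdone
  budget := h.flushing.budget_install hε
  replays := h.replays
  overflow_nil := rfl
  tailCap_eq := congrArg (bufLen ε) h.flushing.totalVol_eq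
  tail_log_le := by simp [State.install]
  layoutEnd_le := h.flushing.layoutEnd_install.trans_le h.flushing.goal_end
  ledger := by
    have hledger := h.ledger
    rw [hdone, moveVol_nil] at hledger
    exact hledger.advance (List.suffix_refl _)

lemma MovingInv.settle {p : Plan} {D : Directory} (hε : 0 < ε) (hs : s.phase = .moving p)
    (h : MovingInv ε eager k s p D) : PhaseInv ε eager k (s.settle ε) := by
  simp only [State.settle, hs]
  split
  · exact (h.install hε (List.isEmpty_iff.1 ‹_›)).finish rfl
  · exact (phaseInv_moving hs).2 ⟨fun hnil => ‹¬_› (List.isEmpty_iff.2 hnil), D, h⟩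

end PhaseInv

/-! ### Carrying out an insertion or deletion -/

/-- The state `s` with the objects `D` meets the conditions for starting a flush, triggered by the
insertion or deletion of an object of length `w`.  An inserted object is in the tail buffer by then;
a deleted one is not in `D` any more, but helps to pay for the segments. -/
structure FlushReady (ε : ℝ) (s : State) (w : ℕ) (isInsert : Bool) (D : Multiset (ℕ × ℕ)) :
    Prop where
  stored : Stored ε (if isInsert then w else 0) s D
  size_le : w ≤ s.maxLen
  le_tail : (if isInsert then w else 0) ≤ vol s.tail
  payCap_le : ∀ i < sizeClass w,
    (s.region i).payCap ≤ classLength i D + vol (ofClass i s.bufferItems)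
  layoutEnd_le : ((s.layoutEnd + (if isInsert then w else 0) : ℕ) : ℝ) ≤
    (1 + 8 * ε) * (totalLength D + (if isInsert then 0 else w) : ℕ)
  bufferSpace_le : (s.bufferSpace : ℝ) ≤
    4 * ε * (totalLength D + (if isInsert then 0 else w) : ℕ)

/-- The state `r` arises from `s` by starting a flush with the objects `D`, because an item of
length `w` does not fit into the tail buffer. -/
structure TriggersFlush (ε : ℝ) (s : State) (w : ℕ) (D : Multiset (ℕ × ℕ)) (r : State) :
    Prop where
  tailCap_lt : s.tailCap < vol s.tail + w
  exists_ready : ∃ s₁ isInsert, FlushReady ε s₁ w isInsert D ∧ s₁.log = s.log ∧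
    s₁.active = s.active ∧ r = s₁.startFlush ε w isInsert

section Perform

variable {ε : ℝ} {s : State} {w : ℕ}

lemma FlushReady.movingInv_startFlush {eager : Bool} {k : ℕ} {isInsert : Bool} (hε : 0 < ε)
    (hε' : ε ≤ 1 / 4) (h : FlushReady ε s w isInsert s.active) (hlog : s.log = [])
    (hwork : eager = true → 2 / ε * w ≤ 3 * totalLength s.active + k) :
    MovingInv ε eager k (s.startFlush ε w isInsert) (s.flushPlan ε w isInsert) s.active := by
  have hflush := h.stored.startFlush h.size_le h.le_tail h.payCap_le
  have hstart := h.stored.logStart_le hε hε' hflush h.le_tail (Nat.le_add_right _ _)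
    h.layoutEnd_le h.bufferSpace_le
  have hmoves : (moveVol (s.flushPlan ε w isInsert).moves : ℝ) ≤ 2 * totalLength s.active := by
    exact_mod_cast h.stored.moveVol_flushMoves_le _ _
  have hlog' : (s.startFlush ε w isInsert).log = [] := hlog
  refine ⟨hflush, by rw [hlog']; rfl, ?_⟩
  rw [hlog', vol_nil, add_zero]
  exact
  { logEnd_eq := rfl
    logStart_le := hstart
    startVol_le := le_rfl
    work_le := by
      rw [Nat.cast_zero]
      linarith [(Nat.cast_nonneg k : (0 : ℝ) ≤ k)]
    pending_le := fun he => by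
      have hpending : 2 / ε * ((s.startFlush ε w isInsert).pending : ℝ) ≤ 2 / ε * w := by
        gcongr
        simp only [State.startFlush]
        split <;> omega
      linarith [hwork he]
    log_fits := by simp [hlog']
    log_end := by simp [hlog']
    log_size := by simp [hlog'] }

lemma TriggersFlush.exists_movingInv {eager : Bool} {k : ℕ} {r : State} (hε : 0 < ε)
    (hε' : ε ≤ 1 / 4) (h : TriggersFlush ε s w s.active r) (hlog : s.log = [])
    (hwork : eager = true → 2 / ε * w ≤ 3 * totalLength s.active + k) :
    ∃ p D, r.phase = .moving p ∧ MovingInv ε eager k r p D := by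
  obtain ⟨s₁, isInsert, hready, hlog₁, hactive, rfl⟩ := h.exists_ready
  rw [← hactive] at hready hwork
  exact ⟨_, _, rfl, hready.movingInv_startFlush hε hε' (hlog₁.trans hlog) hwork⟩

lemma coe_update_delete (D : Directory) (n : ℕ) :
    ((D.update (.delete n) : Directory) : Multiset (ℕ × ℕ)) =
      (D : Multiset (ℕ × ℕ)).filter fun p => p.1 ≠ n := by
  simp [Directory.update]

lemma Stored.performInsert {D : Directory} {n : ℕ} (hε : 0 < ε) (hε' : ε ≤ 1 / 4)
    (h : Stored ε 0 s D) (hb : Budget ε s D) (hn : n ∉ D.map Prod.fst) (hw : 1 ≤ w)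
    (hwΔ : w ≤ s.maxLen) :
    StoresInto ε s w (D.update (.insert n w) : Directory) (s.performInsert ε n w) ∨
      TriggersFlush ε s w (D.update (.insert n w) : Directory) (s.performInsert ε n w) := by
  set x : Item := ⟨n, w, 0, .live⟩
  have hD : ((D.update (.insert n w) : Directory) : Multiset (ℕ × ℕ)) = (n, w) ::ₘ ↑D := rfl
  have hadd : liveObjects [x] + (D : Multiset (ℕ × ℕ)) = (n, w) ::ₘ ↑D := by
    simp [x, liveObjects_cons]
  have hproper : ProperObjects ((n, w) ::ₘ (D : Multiset (ℕ × ℕ))) s.maxLen :=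
    h.proper.cons (by simpa using hn) hw hwΔ
  rw [hD, ← hadd]
  rw [← hadd] at hproper
  unfold State.performInsert
  split
  · rename_i s' hs
    refine .inl (StoresInto.of_tryStore_eq_some h ?_ hproper hs)
    rw [← Multiset.singleton_add, ← add_assoc]
    exact hb.mono hε
  · rename_i hs
    have hfull : s.tailCap < vol s.tail + w := tailCap_lt_of_tryStore_eq_none hs
    have htail := h.tail_vol
    have hlayout := hb.layoutEnd_le hε hε' h.toRegular htail
    have hbuffers := hb.bufferSpace_le hε hε' h.toRegular htail
    refine .inr ⟨hfull, s.pushTail x, true, ?_, rfl, rfl, rfl⟩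
    exact
    { stored := h.pushTail (Nat.zero_le w) (by simp only [x]; omega) hproper
      size_le := hwΔ
      le_tail := by simp [State.pushTail, x]
      payCap_le := fun i _ => (hb.payCap_le i).trans (by simp [bufferItems_pushTail]; omega)
      layoutEnd_le := by
        have heq : (s.pushTail x).layoutEnd = s.layoutEnd := rfl
        have hεw : 0 ≤ ε * w := by positivity
        rw [heq, hadd, totalLength_cons]
        simp only [if_true]
        push_cast
        linarith
      bufferSpace_le := by
        refine hbuffers.trans ?_
        gcongr
        rw [hadd, totalLength_cons]
        omega }

lemma Stored.performDelete {D : Directory} {n : ℕ} (hε : 0 < ε) (hε' : ε ≤ 1 / 4)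
    (h : Stored ε 0 s D) (hb : Budget ε s D) (hoverflow : s.overflow = []) (hn : (n, w) ∈ D) :
    StoresInto ε s w (D.update (.delete n) : Directory) (s.performDelete ε n w) ∨
      TriggersFlush ε s w (D.update (.delete n) : Directory) (s.performDelete ε n w) := by
  have hdead := h.markDead n
  have hsplit := cons_filter_fst_ne h.proper.nodup (Multiset.mem_coe.2 hn)
  have hbdead : Budget ε (s.markDead n) D := hb.mapItems (Item.size_bury n)
  have hvol : vol (s.markDead n).tail = vol s.tail := vol_map (Item.size_bury n) _
  rw [← coe_update_delete] at hdead hsplit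
  rw [← hsplit] at hbdead
  unfold State.performDelete
  split
  · rename_i s' hs
    have hnone : liveObjects [(⟨n, w, 0, .record⟩ : Item)] = 0 := by simp [liveObjects_cons]
    left
    have hstores := StoresInto.of_tryStore_eq_some hdead
      (by rw [hnone, zero_add]; exact hbdead) (by rw [hnone, zero_add]; exact hdead.proper) hs
    rw [hnone, zero_add] at hstores
    obtain ⟨reg, tl, rfl⟩ := hstores.eq_with
    exact
    { eq_with := ⟨reg, tl, by simp [State.markDead, State.mapItems, hoverflow]⟩
      stored := hstores.stored
      budget := hstores.budget
      tail_vol_le := hvol ▸ hstores.tail_vol_le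
      layoutEnd_eq := hstores.layoutEnd_eq }
  · rename_i hs
    have hfull := tailCap_lt_of_tryStore_eq_none hs
    rw [hvol] at hfull
    have hlayout := hbdead.layoutEnd_le hε hε' hdead.toRegular hdead.tail_vol
    have hbuffers := hbdead.bufferSpace_le hε hε' hdead.toRegular hdead.tail_vol
    rw [totalLength_cons, add_comm w] at hlayout hbuffers
    refine .inr ⟨hfull, s.markDead n, false, ?_, rfl, rfl, rfl⟩
    exact
    { stored := hdead
      size_le := (h.proper.length_mem _ (Multiset.mem_coe.2 hn)).2
      le_tail := Nat.zero_le _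
      payCap_le := fun i hi => by
        have hpay := hbdead.payCap_le i
        rwa [classLength_cons, if_neg (by simpa using hi.ne'), zero_add] at hpay
      layoutEnd_le := hlayout
      bufferSpace_le := hbuffers }

/-- Insert or delete the object that an item of the log stands for. -/
noncomputable def State.perform (ε : ℝ) (s : State) (x : Item) : State :=
  if x.kind = .live then s.performInsert ε x.name x.size else s.performDelete ε x.name x.size

lemma Stored.perform {D D' : Directory} {x : Item} (hε : 0 < ε) (hε' : ε ≤ 1 / 4)
    (h : Stored ε 0 s D) (hb : Budget ε s D) (hoverflow : s.overflow = [])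
    (hx : Replays D [x] D') (hsize : 1 ≤ x.size ∧ x.size ≤ s.maxLen) :
    StoresInto ε s x.size D' (s.perform ε x) ∨
      TriggersFlush ε s x.size D' (s.perform ε x) := by
  simp only [Replays] at hx
  unfold State.perform
  split at hx
  · obtain ⟨hn, rfl⟩ := hx
    rw [if_pos ‹_›]
    exact h.performInsert hε hε' hb hn hsize.1 hsize.2
  · obtain ⟨hn, rfl⟩ := hx
    rw [if_neg ‹_›]
    exact h.performDelete hε hε' hb hoverflow hn

end Perform

/-! ### The steps of a flush -/

/-- The volume of the work still due after a step of volume `v` from `s` to `s'`, if it was `k`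
before: triggering a new flush cancels the rest unless `eager` holds. -/
def workLeft (eager : Bool) (k v : ℕ) (s s' : State) : ℕ :=
  if triggered s s' && !eager then 0 else k - v

section Step

variable {ε : ℝ} {eager : Bool} {k : ℕ} {s : State} {D : Directory} {Vf W : ℕ}

lemma triggered_eq_false {s' : State} (h : ∀ p, s'.phase ≠ .moving p) :
    triggered s s' = false := by
  unfold triggered
  split
  · exact absurd ‹_› (h _)
  · rfl

lemma triggered_eq_false_of_moving {p : Plan} (hs : s.phase = .moving p) (s' : State) :
    triggered s s' = false := by
  rw [triggered, hs]

lemma workLeft_of_eager (he : eager = true) (v : ℕ) (s s' : State) :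
    workLeft eager k v s s' = k - v := by
  simp [workLeft, he]

lemma finish_phase_ne_moving (hs : s.phase = .draining) (p : Plan) :
    s.finish.phase ≠ .moving p := by
  unfold State.finish
  split
  · exact nofun
  · rw [hs]
    exact nofun

lemma settle_eq_finish (hs : s.phase = .draining) : s.settle ε = s.finish := by
  rw [State.settle, hs]

lemma step_moving {b : ℕ} {cv : ℕ → ℕ} {tv : ℕ} {m : Move} {ms : List Move}
    (hs : s.phase = .moving ⟨b, cv, tv, m :: ms⟩) :
    s.step ε = ((State.relocate { s with phase := .moving ⟨b, cv, tv, ms⟩ } m).settle ε,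
      m.size) := by
  rw [State.step, hs]

lemma step_draining {x : Item} {xs : List Item} (hs : s.phase = .draining)
    (hlog : s.log = x :: xs) :
    s.step ε = ((State.perform ε { s with log := xs } x).settle ε, x.size) := by
  rw [State.step, hs, hlog]
  rfl

lemma MovingInv.relocate {b : ℕ} {cv : ℕ → ℕ} {tv : ℕ} {m : Move} {ms : List Move}
    (h : MovingInv ε eager k s ⟨b, cv, tv, m :: ms⟩ D) :
    MovingInv ε eager (k - m.size)
      (State.relocate { s with phase := .moving ⟨b, cv, tv, ms⟩ } m) ⟨b, cv, tv, ms⟩ D where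
  flushing := Flushing.relocate (h.flushing.of_sameStorage ⟨rfl, rfl, rfl, rfl, le_rfl⟩ rfl)
  replays := h.replays
  ledger := by
    have hledger := h.ledger
    rw [moveVol_cons, add_assoc] at hledger
    exact hledger.advance (List.suffix_refl _)

lemma DrainInv.of_storesInto {x : Item} {xs : List Item} {D' : Directory} {r : State}
    (h : DrainInv ε eager k s D Vf W) (hlog : s.log = x :: xs)
    (hr : StoresInto ε { s with log := xs } x.size D' r) (hD' : Replays D' xs s.active) :
    DrainInv ε eager (k - x.size) r D' Vf W := by
  have htail := hr.tail_vol_le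
  have hlayout := hr.layoutEnd_eq
  have htotal := h.tail_log_le
  have hledger := h.ledger
  rw [hlog, vol_cons] at htotal hledger
  obtain ⟨reg, tl, rfl⟩ := hr.eq_with
  exact
  { stored := hr.stored
    budget := hr.budget
    replays := hD'
    overflow_nil := h.overflow_nil
    tailCap_eq := h.tailCap_eq
    tail_log_le := by
      dsimp only at htail ⊢
      omega
    layoutEnd_le := hlayout.trans_le h.layoutEnd_le
    ledger := hledger.advance (hlog ▸ List.suffix_cons x xs) }

/-- By `Ledger.log_fits`, the log without its last item fits into the empty tail buffer. -/
lemma DrainInv.log_eq_singleton {x : Item} {xs : List Item} (h : DrainInv ε eager k s D Vf W)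
    (hlog : s.log = x :: xs) (hfull : s.tailCap < vol s.tail + x.size) : xs = [] := by
  obtain rfl | ⟨l, y, rfl⟩ := List.eq_nil_or_concat' xs
  · rfl
  · have hfits := h.ledger.log_fits (x :: l) y hlog
    have htotal := h.tail_log_le
    rw [hlog, vol_cons, vol_append, vol_cons, vol_nil] at htotal
    have hcap := h.tailCap_eq
    omega

lemma Ledger.trigger_le {x : Item} (hε : 0 < ε) (hε' : ε ≤ 1 / 4)
    (h : Ledger ε eager k s Vf W x.size) (hlog : s.log = [x]) (hxW : x.size ≤ W) :
    2 / ε * x.size ≤ 3 * totalLength s.active + (k - x.size : ℕ) := by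
  have hwork := h.work_le
  have hfits : (W : ℝ) ≤ ε * Vf + x.size := by
    have hle : (W : ℝ) ≤ bufLen ε Vf + x.size := by exact_mod_cast h.log_fits [] x hlog
    linarith [bufLen_le hε Vf]
  have hVf : (Vf : ℝ) ≤ totalLength s.active + W := by exact_mod_cast h.startVol_le
  have hk : (k : ℝ) ≤ (k - x.size : ℕ) + x.size := by
    exact_mod_cast (by omega : k ≤ k - x.size + x.size)
  have hεVf : ε * Vf ≤ Vf / 4 := by nlinarith [(Nat.cast_nonneg Vf : (0 : ℝ) ≤ Vf)]
  have hmono : 4 / ε * x.size ≤ 4 / ε * W := by gcongr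
  have hlarge : 8 * (x.size : ℝ) ≤ 2 / ε * x.size := by
    gcongr
    rw [le_div_iff₀ hε]
    linarith
  have hdouble : 4 / ε * x.size = 2 / ε * x.size + 2 / ε * x.size := by ring
  linarith [(Nat.cast_nonneg Vf : (0 : ℝ) ≤ Vf)]

lemma Replays.exists_head {x : Item} {xs : List Item} {A : Directory}
    (h : Replays D (x :: xs) A) : ∃ D', Replays D [x] D' ∧ Replays D' xs A := by
  simp only [Replays] at h ⊢
  split at h
  · exact ⟨_, (if_pos ‹_›).mpr ⟨h.1, rfl⟩, h.2⟩
  · exact ⟨_, (if_neg ‹_›).mpr ⟨h.1, rfl⟩, h.2⟩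

lemma DrainInv.settle_perform {x : Item} {xs : List Item} (hε : 0 < ε) (hε' : ε ≤ 1 / 4)
    (hs : s.phase = .draining) (hlog : s.log = x :: xs) (h : DrainInv ε eager k s D Vf W) :
    PhaseInv ε eager
      (workLeft eager k x.size s ((State.perform ε { s with log := xs } x).settle ε))
      ((State.perform ε { s with log := xs } x).settle ε) := by
  obtain ⟨D', hx, hxs⟩ := (hlog ▸ h.replays).exists_head
  have hsame : SameStorage s { s with log := xs } := ⟨rfl, rfl, rfl, rfl, le_rfl⟩
  rcases (h.stored.of_sameStorage hsame).perform hε hε'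
      (h.budget.of_sameStorage h.stored.toRegular hsame) h.overflow_nil hx
      (h.ledger.log_size x (by simp [hlog])) with hr | hr
  · have hphase : (State.perform ε { s with log := xs } x).phase = .draining := by
      obtain ⟨reg, tl, heq⟩ := hr.eq_with
      rw [heq]
      exact hs
    rw [settle_eq_finish hphase, workLeft, triggered_eq_false (finish_phase_ne_moving hphase)]
    exact (h.of_storesInto hlog hr hxs).finish hphase
  · obtain rfl : xs = [] := h.log_eq_singleton hlog hr.tailCap_lt
    obtain rfl : D' = s.active := hxs
    have hledger := h.ledger
    have htotal := h.tail_log_le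
    rw [hlog, vol_cons, vol_nil, add_zero] at hledger htotal
    have hwork := hledger.trigger_le hε hε' hlog (by omega)
    obtain ⟨p, D, hp, hmoving⟩ := hr.exists_movingInv (eager := eager)
      (k := workLeft eager k x.size s ((State.perform ε { s with log := [] } x).settle ε))
      hε hε' rfl fun he => by
        rw [workLeft_of_eager he]
        exact hwork
    exact hmoving.settle hε hp

lemma PhaseInv.step (hε : 0 < ε) (hε' : ε ≤ 1 / 4) (hs : s.phase ≠ .idle)
    (h : PhaseInv ε eager k s) : 1 ≤ (s.step ε).2 ∧
      PhaseInv ε eager (workLeft eager k (s.step ε).2 s (s.step ε).1) (s.step ε).1 := by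
  cases hp : s.phase with
  | idle => exact absurd hp hs
  | moving p =>
    obtain ⟨hne, D, hmoving⟩ := (phaseInv_moving hp).1 h
    obtain ⟨b, cv, tv, ms⟩ := p
    obtain ⟨m, ms, rfl⟩ := List.exists_cons_of_ne_nil hne
    rw [step_moving hp, workLeft, triggered_eq_false_of_moving hp]
    have hm := hmoving.flushing.moves_mem m List.mem_cons_self
    exact ⟨(hmoving.flushing.proper.length_mem _ hm).1, hmoving.relocate.settle hε rfl⟩
  | draining =>
    obtain ⟨hne, D, Vf, W, hdrain⟩ := (phaseInv_draining hp).1 h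
    obtain ⟨x, xs, hlog⟩ := List.exists_cons_of_ne_nil hne
    rw [step_draining hp hlog]
    exact ⟨(hdrain.ledger.log_size x (by simp [hlog])).1,
      hdrain.settle_perform hε hε' hp hlog⟩

lemma PhaseInv.work (hε : 0 < ε) (hε' : ε ≤ 1 / 4) (h : PhaseInv ε eager k s) :
    PhaseInv ε eager 0 (s.work ε eager k) := by
  induction k using Nat.strong_induction_on generalizing s with
  | _ k ih =>
    cases k with
    | zero => rwa [State.work]
    | succ k =>
      rw [State.work]
      split
      · exact (phaseInv_idle ‹_›).2 ((phaseInv_idle ‹_›).1 h)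
      · obtain ⟨hv, hstep⟩ := h.step hε hε' ‹_›
        unfold workLeft at hstep
        dsimp only
        split
        · rwa [if_pos ‹_›] at hstep
        · rw [if_neg ‹_›, show k + 1 - (s.step ε).2 = k - ((s.step ε).2 - 1) by omega] at hstep
          exact ih _ (by omega) hstep

end Step

/-! ### Active objects and maximum length -/

/-- The states `s` and `s'` have the same active objects and the same maximum length. -/
structure SameDirectory (s s' : State) : Prop where
  active_eq : s'.active = s.active
  maxLen_eq : s'.maxLen = s.maxLen

section SameDirectory

variable {s s' s'' : State}

lemma SameDirectory.refl (s : State) : SameDirectory s s := ⟨rfl, rfl⟩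

lemma SameDirectory.trans (h : SameDirectory s s') (h' : SameDirectory s' s'') :
    SameDirectory s s'' :=
  ⟨h'.active_eq.trans h.active_eq, h'.maxLen_eq.trans h.maxLen_eq⟩

lemma sameDirectory_finish (s : State) : SameDirectory s s.finish := by
  unfold State.finish
  split <;> exact ⟨rfl, rfl⟩

lemma sameDirectory_settle (ε : ℝ) (s : State) : SameDirectory s (s.settle ε) := by
  unfold State.settle
  split
  · split
    · exact SameDirectory.trans (s' := s.install ε _) ⟨rfl, rfl⟩ (sameDirectory_finish _)
    · exact .refl s
  · exact sameDirectory_finish s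

lemma sameDirectory_of_tryStore_eq_some {x : Item} (h : s.tryStore x = some s') :
    SameDirectory s s' := by
  unfold State.tryStore at h
  split at h
  · obtain rfl := Option.some.inj h
    exact ⟨rfl, rfl⟩
  · obtain ⟨-, h⟩ := Option.ite_none_right_eq_some.1 h
    obtain rfl := Option.some.inj h
    exact ⟨rfl, rfl⟩

lemma sameDirectory_perform (ε : ℝ) (s : State) (x : Item) :
    SameDirectory s (s.perform ε x) := by
  unfold State.perform State.performInsert State.performDelete
  split <;> split
  · exact sameDirectory_of_tryStore_eq_some ‹_›
  · exact ⟨rfl, rfl⟩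
  · exact SameDirectory.trans (s' := s.markDead x.name) ⟨rfl, rfl⟩
      (sameDirectory_of_tryStore_eq_some ‹_›)
  · exact ⟨rfl, rfl⟩

lemma sameDirectory_step (ε : ℝ) (s : State) : SameDirectory s (s.step ε).1 := by
  unfold State.step
  split
  · dsimp only
    refine SameDirectory.trans ?_ (sameDirectory_settle ε _)
    exact ⟨rfl, rfl⟩
  · dsimp only
    refine SameDirectory.trans ?_ (sameDirectory_settle ε _)
    exact SameDirectory.trans (s' := { s with log := ‹_› }) ⟨rfl, rfl⟩
      (sameDirectory_perform ε _ ‹_›)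
  · exact .refl s

lemma sameDirectory_work (ε : ℝ) (eager : Bool) (k : ℕ) (s : State) :
    SameDirectory s (s.work ε eager k) := by
  induction k using Nat.strong_induction_on generalizing s with
  | _ k ih =>
    cases k with
    | zero =>
      rw [State.work]
      exact .refl s
    | succ k =>
      rw [State.work]
      split
      · exact .refl s
      · dsimp only
        split
        · exact sameDirectory_step ε s
        · exact (sameDirectory_step ε s).trans (ih _ (by omega) _)

end SameDirectory

/-! ### Processing a request -/

/-- The state `s` after taking note of the request `r`. -/
def State.announce (s : State) (r : Request) : State :=
  { s with active := s.active.update r, maxLen := r.maxLength s.maxLen }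

/-- The item that stands for the request `r` in a buffer or in the log. -/
def State.requestItem (s : State) : Request → Item
  | .insert n w => ⟨n, w, 0, .live⟩
  | .delete n => ⟨n, s.active.lengthOf n, 0, .record⟩

/-- The request `r` is legal if the active objects are those of `A`. -/
def Legal (A : Directory) : Request → Prop
  | .insert n w => 1 ≤ w ∧ n ∉ A.map Prod.fst
  | .delete n => n ∈ A.map Prod.fst

section RunInv

variable {ε : ℝ} {eager : Bool} {s : State} {r : Request}

lemma process_of_idle (hs : s.phase = .idle) : s.process ε eager r =
    if eager then (((s.announce r).perform ε (s.requestItem r)).settle ε).work ε eager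
      (workVolume ε (s.requestItem r).size)
    else ((s.announce r).perform ε (s.requestItem r)).settle ε := by
  unfold State.process
  dsimp only
  split
  · cases r <;> rfl
  · exact absurd hs ‹_›

lemma process_of_ne_idle (hs : s.phase ≠ .idle) : s.process ε eager r =
    ((s.announce r).pushLog (s.requestItem r)).work ε eager
      (workVolume ε (s.requestItem r).size) := by
  unfold State.process
  dsimp only
  split
  · exact absurd ‹_› hs
  · cases r <;> rfl

lemma sameDirectory_process (ε : ℝ) (eager : Bool) (s : State) (r : Request) :
    SameDirectory (s.announce r) (s.process ε eager r) := by
  by_cases hs : s.phase = .idle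
  · rw [process_of_idle hs]
    have hsettle := (sameDirectory_perform ε (s.announce r) (s.requestItem r)).trans
      (sameDirectory_settle ε _)
    split
    · exact hsettle.trans (sameDirectory_work _ _ _ _)
    · exact hsettle
  · rw [process_of_ne_idle hs]
    exact SameDirectory.trans (s' := (s.announce r).pushLog (s.requestItem r)) ⟨rfl, rfl⟩
      (sameDirectory_work _ _ _ _)

lemma le_maxLength (r : Request) (Δ : ℕ) : Δ ≤ r.maxLength Δ := by
  cases r with
  | insert n w => exact le_max_left _ _
  | delete n => exact le_rfl

lemma ProperObjects.update {A : Directory} {Δ : ℕ} (h : ProperObjects (A : Multiset (ℕ × ℕ)) Δ)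
    (hr : Legal A r) :
    ProperObjects ((A.update r : Directory) : Multiset (ℕ × ℕ)) (r.maxLength Δ) := by
  cases r with
  | insert n w =>
    exact (h.mono (le_max_left _ _)).cons (by simpa using hr.2) hr.1 (le_max_right _ _)
  | delete n =>
    rw [coe_update_delete]
    exact h.filter _

lemma mem_lengthOf {A : Directory} {n : ℕ} (h : n ∈ A.map Prod.fst) :
    (n, A.lengthOf n) ∈ A := by
  induction A with
  | nil => simp at h
  | cons p A ih =>
    obtain ⟨m, v⟩ := p
    by_cases hm : n = m
    · simp [Directory.lengthOf, hm]
    · have hmem := ih (by simpa [hm] using h)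
      have hlength : Directory.lengthOf ((m, v) :: A) n = Directory.lengthOf A n := by
        simp [Directory.lengthOf, List.lookup_cons, beq_false_of_ne hm]
      rw [hlength]
      exact List.mem_cons_of_mem _ hmem

lemma size_requestItem_mem (h : ProperObjects (s.active : Multiset (ℕ × ℕ)) s.maxLen)
    (hr : Legal s.active r) :
    1 ≤ (s.requestItem r).size ∧ (s.requestItem r).size ≤ r.maxLength s.maxLen := by
  cases r with
  | insert n w => exact ⟨hr.1, le_max_right _ _⟩
  | delete n => exact h.length_mem _ (mem_lengthOf hr)

lemma replays_requestItem (hr : Legal s.active r) :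
    Replays s.active [s.requestItem r] (s.active.update r) := by
  cases r with
  | insert n w => exact ⟨hr.2, rfl⟩
  | delete n => exact ⟨mem_lengthOf hr, rfl⟩

lemma totalLength_active_le (h : ProperObjects (s.active : Multiset (ℕ × ℕ)) s.maxLen)
    (hr : Legal s.active r) :
    totalLength s.active ≤ totalLength (s.active.update r : Directory) +
      (s.requestItem r).size := by
  cases r with
  | insert n w =>
    exact ((Nat.le_add_left _ _).trans_eq (totalLength_cons (n, w) s.active).symm).trans
      (Nat.le_add_right _ _)
  | delete n =>
    rw [coe_update_delete]
    have hsplit := cons_filter_fst_ne h.nodup (Multiset.mem_coe.2 (mem_lengthOf hr))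
    have htotal := congrArg totalLength hsplit
    rw [totalLength_cons] at htotal
    exact htotal.ge.trans_eq (add_comm _ _)

lemma PhaseInv.pushLog (hε : 0 < ε) (hε' : ε ≤ 1 / 4) (hs : s.phase ≠ .idle)
    (h : PhaseInv ε eager 0 s) (hA : ProperObjects (s.active : Multiset (ℕ × ℕ)) s.maxLen)
    (hr : Legal s.active r) :
    PhaseInv ε eager (workVolume ε (s.requestItem r).size)
      ((s.announce r).pushLog (s.requestItem r)) := by
  have hΔ := le_maxLength r s.maxLen
  have hV := totalLength_active_le hA hr
  have hsize := size_requestItem_mem hA hr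
  have hsame : SameStorage s ((s.announce r).pushLog (s.requestItem r)) :=
    ⟨rfl, rfl, rfl, rfl, hΔ⟩
  have hx : Replays s.active [{ s.requestItem r with addr := s.logEnd }] (s.active.update r) :=
    replays_requestItem hr
  cases hp : s.phase with
  | idle => exact absurd hp hs
  | moving p =>
    obtain ⟨hne, D, hmoving⟩ := (phaseInv_moving hp).1 h
    refine (phaseInv_moving (s := (s.announce r).pushLog _) hp).2 ⟨hne, D,
      hmoving.flushing.of_sameStorage hsame rfl,
      hmoving.replays.append_singleton hx, ?_⟩
    have hledger := hmoving.ledger.pushLog hε hε' hΔ hV hsize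
    simpa [State.pushLog, State.announce, add_assoc] using hledger
  | draining =>
    obtain ⟨-, D, Vf, W, hdrain⟩ := (phaseInv_draining hp).1 h
    refine (phaseInv_draining (s := (s.announce r).pushLog _) hp).2
      ⟨by simp [State.pushLog], D, Vf, W + (s.requestItem r).size, ?_⟩
    have hledger := hdrain.ledger.pushLog hε hε' hΔ hV hsize
    exact
    { stored := hdrain.stored.of_sameStorage hsame
      budget := hdrain.budget.of_sameStorage hdrain.stored.toRegular hsame
      replays := hdrain.replays.append_singleton hx
      overflow_nil := hdrain.overflow_nil
      tailCap_eq := hdrain.tailCap_eq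
      tail_log_le := by
        have htotal := hdrain.tail_log_le
        simp only [State.pushLog, State.announce, vol_append, vol_cons, vol_nil]
        omega
      layoutEnd_le := (hsame.layoutEnd_eq hdrain.stored.toRegular).trans_le hdrain.layoutEnd_le
      ledger := by simpa [State.pushLog, State.announce] using hledger }

lemma settle_of_idle (hs : s.phase = .idle) : s.settle ε = s := by
  unfold State.settle State.finish
  simp only [hs]

lemma IdleInv.settle_perform {k : ℕ} (hε : 0 < ε) (hε' : ε ≤ 1 / 4) (hs : s.phase = .idle)
    (h : IdleInv ε s) (hA : ProperObjects (s.active : Multiset (ℕ × ℕ)) s.maxLen)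
    (hr : Legal s.active r) (hk : eager = true → 4 / ε * (s.requestItem r).size ≤ k) :
    PhaseInv ε eager k (((s.announce r).perform ε (s.requestItem r)).settle ε) := by
  have hsame : SameStorage s (s.announce r) := ⟨rfl, rfl, rfl, rfl, le_maxLength r _⟩
  rcases (h.stored.of_sameStorage hsame).perform hε hε'
      (h.budget.of_sameStorage h.stored.toRegular hsame) h.overflow_nil
      (replays_requestItem hr) (size_requestItem_mem hA hr) with hstores | htriggers
  · have hstored := hstores.stored
    have hbudget := hstores.budget
    obtain ⟨reg, tl, heq⟩ := hstores.eq_with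
    rw [heq] at hstored hbudget ⊢
    have hidle : ({ s.announce r with region := reg, tail := tl } : State).phase = .idle := hs
    rw [settle_of_idle hidle]
    exact (phaseInv_idle hidle).2
      ⟨hstored, hbudget, h.overflow_nil, h.log_nil⟩
  · obtain ⟨p, D, hp, hmoving⟩ :=
      htriggers.exists_movingInv (s := s.announce r) (k := k) hε hε' h.log_nil fun he => by
        have hle : 2 / ε * ((s.requestItem r).size : ℝ) ≤ 4 / ε * (s.requestItem r).size := by
          gcongr
          norm_num
        linarith [hk he]
    exact hmoving.settle hε hp

lemma PhaseInv.process (hε : 0 < ε) (hε' : ε ≤ 1 / 4) (h : PhaseInv ε eager 0 s)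
    (hA : ProperObjects (s.active : Multiset (ℕ × ℕ)) s.maxLen) (hr : Legal s.active r) :
    PhaseInv ε eager 0 (s.process ε eager r) := by
  by_cases hs : s.phase = .idle
  · have hidle := (phaseInv_idle hs).1 h
    rw [process_of_idle hs]
    split
    · exact (hidle.settle_perform hε hε' hs hA hr fun _ => le_workVolume _ _).work hε hε'
    · exact hidle.settle_perform hε hε' hs hA hr fun he => absurd he ‹_›
  · rw [process_of_ne_idle hs]
    exact (h.pushLog hε hε' hs hA hr).work hε hε'

lemma phaseInv_init (ε : ℝ) (eager : Bool) : PhaseInv ε eager 0 State.init := by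
  have hbuffer : State.init.bufferItems = [] := by simp [State.bufferItems, State.init]
  refine (phaseInv_idle rfl).2 ⟨⟨⟨?_, ?_, ?_, ?_, ?_⟩, ⟨?_, ?_⟩, ?_, ?_, ?_, ?_⟩,
    ⟨?_, by rw [hbuffer]; simp [State.init]⟩, rfl, rfl⟩
  all_goals simp [State.init, Region.items, liveObjects_mainItems]

/-- What holds after each request, given the active objects `A` and the maximum length `Δ`. -/
structure RunInv (ε : ℝ) (eager : Bool) (A : Directory) (Δ : ℕ) (s : State) : Prop where
  active_eq : s.active = A
  maxLen_eq : s.maxLen = Δ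
  proper : ProperObjects (A : Multiset (ℕ × ℕ)) Δ
  phaseInv : PhaseInv ε eager 0 s

lemma validFrom_cons {A : Directory} {rs : List Request} :
    ValidFrom A (r :: rs) ↔ Legal A r ∧ ValidFrom (A.update r) rs := by
  cases r with
  | insert n w => exact and_assoc.symm
  | delete n => exact Iff.rfl

lemma RunInv.foldl_process {A : Directory} {Δ : ℕ} {rs : List Request} (hε : 0 < ε)
    (hε' : ε ≤ 1 / 4) (h : RunInv ε eager A Δ s) (hrs : ValidFrom A rs) :
    RunInv ε eager (rs.foldl Directory.update A) (rs.foldl Request.maxLength Δ)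
      (rs.foldl (State.process ε eager) s) := by
  induction rs generalizing s A Δ with
  | nil => exact h
  | cons r rs ih =>
    obtain ⟨rfl, rfl, hproper, hphase⟩ := h
    obtain ⟨hr, hrs⟩ := validFrom_cons.1 hrs
    have hdir := sameDirectory_process ε eager s r
    exact ih ⟨hdir.active_eq, hdir.maxLen_eq, hproper.update hr,
      hphase.process hε hε' hproper hr⟩ hrs

lemma runInv_run {rs : List Request} (hε : 0 < ε) (hε' : ε ≤ 1 / 4) (hrs : Valid rs) :
    RunInv ε eager (rs.foldl Directory.update []) (longest rs) (run ε eager rs) :=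
  RunInv.foldl_process hε hε' ⟨rfl, rfl, ⟨by simp, by simp⟩, phaseInv_init ε eager⟩ hrs

end RunInv

/-! ### The total space used -/

section Space

variable {ε : ℝ} {eager : Bool} {s : State}

lemma space_le {a : ℕ} (hlayout : s.layoutEnd ≤ a)
    (hitems : ∀ x ∈ s.mainItems ++ s.overflow, x.addr + x.size ≤ a)
    (hlog : ∀ x ∈ s.log, x.addr + x.size ≤ a) (hphase : s.phase ≠ .idle → s.logEnd ≤ a) :
    s.space ≤ a := by
  refine max_le hlayout (max_le (lastCell_le (List.forall_mem_append.2 ⟨hitems, hlog⟩)) ?_)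
  split
  · exact Nat.zero_le a
  · exact hphase ‹_›

lemma IdleInv.space_le (hs : s.phase = .idle) (h : IdleInv ε s) : s.space ≤ s.layoutEnd :=
  StorageRealloc.space_le le_rfl
    (by simpa [h.overflow_nil] using fun x => h.stored.mainItem_end (x := x))
    (by simp [h.log_nil]) fun hne => absurd hs hne

lemma MovingInv.space_le {p : Plan} {D : Directory} {k : ℕ} (h : MovingInv ε eager k s p D) :
    s.space ≤ s.logEnd := by
  have hle : s.logStart ≤ s.logEnd := (Nat.le_add_right _ _).trans_eq h.ledger.logEnd_eq.symm
  exact StorageRealloc.space_le (h.flushing.layout_end.trans hle)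
    (fun x hx => (h.flushing.item_end x hx).trans hle) h.ledger.log_end fun _ => le_rfl

lemma DrainInv.space_le {D : Directory} {Vf W k : ℕ} (h : DrainInv ε eager k s D Vf W) :
    s.space ≤ s.logEnd := by
  have hle : s.layoutEnd ≤ s.logEnd :=
    (h.layoutEnd_le.trans (Nat.le_add_right _ _)).trans_eq h.ledger.logEnd_eq.symm
  refine StorageRealloc.space_le hle (fun x hx => ?_) h.ledger.log_end fun _ => le_rfl
  rw [h.overflow_nil, List.append_nil] at hx
  exact (h.stored.mainItem_end hx).trans hle

lemma PhaseInv.space_le_of_idle (hε : 0 < ε) (hε' : ε ≤ 1 / 4) (hs : s.phase = .idle)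
    (h : PhaseInv ε eager 0 s) : (s.space : ℝ) ≤ (1 + 64 * ε) * totalLength s.active := by
  have hidle := (phaseInv_idle hs).1 h
  calc (s.space : ℝ) ≤ s.layoutEnd := Nat.cast_le.2 (hidle.space_le hs)
    _ ≤ (1 + 8 * ε) * totalLength s.active :=
      hidle.budget.layoutEnd_le hε hε' hidle.stored.toRegular hidle.stored.tail_vol
    _ ≤ (1 + 64 * ε) * totalLength s.active := by
      gcongr
      norm_num

lemma PhaseInv.space_le (hε : 0 < ε) (hε' : ε ≤ 1 / 4) (h : PhaseInv ε eager 0 s) :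
    (s.space : ℝ) ≤ (1 + 64 * ε) *
      (if eager then totalLength s.active else totalLength s.active + s.pending : ℕ) +
      s.maxLen := by
  cases hp : s.phase with
  | idle =>
    have hcounted : totalLength s.active ≤
        if eager then totalLength s.active else totalLength s.active + s.pending := by
      split <;> omega
    calc (s.space : ℝ) ≤ (1 + 64 * ε) * totalLength s.active := h.space_le_of_idle hε hε' hp
      _ ≤ (1 + 64 * ε) *
          (if eager then totalLength s.active else totalLength s.active + s.pending : ℕ) := by
        gcongr
      _ ≤ _ := le_add_of_nonneg_right (Nat.cast_nonneg _)
  | moving p =>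
    obtain ⟨-, D, hmoving⟩ := (phaseInv_moving hp).1 h
    exact (Nat.cast_le.2 hmoving.space_le).trans (hmoving.ledger.logEnd_le hε hε')
  | draining =>
    obtain ⟨-, D, Vf, W, hdrain⟩ := (phaseInv_draining hp).1 h
    exact (Nat.cast_le.2 hdrain.space_le).trans (hdrain.ledger.logEnd_le hε hε')

end Space

lemma phase_eq_idle {φ : Phase} (h : φ.IsIdle) : φ = .idle := by
  cases φ with
  | idle => rfl
  | moving p => exact h.elim
  | draining => exact h.elim

end StorageRealloc

theorem mainTheorem7 :
    ∃ C : ℝ, 0 < C ∧ ∀ ε : ℝ, 0 < ε → ε ≤ 1 / 4 →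
      ∀ (eager : Bool) (rs : List StorageRealloc.Request), StorageRealloc.Valid rs →
        ((StorageRealloc.run ε eager rs).space : ℝ) ≤
            (1 + C * ε) * StorageRealloc.countedVolume ε eager rs +
              StorageRealloc.longest rs ∧
        ((StorageRealloc.run ε eager rs).phase.IsIdle →
          ((StorageRealloc.run ε eager rs).space : ℝ) ≤
            (1 + C * ε) * StorageRealloc.activeVolume rs) := by
  open StorageRealloc in
  refine ⟨64, by norm_num, fun ε hε hε' eager rs hrs => ?_⟩
  have hrun := runInv_run (eager := eager) hε hε' hrs
  have hvolume : totalLength (run ε eager rs).active = activeVolume rs := by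
    rw [hrun.active_eq]
    rfl
  refine ⟨?_, fun hidle => hvolume ▸ hrun.phaseInv.space_le_of_idle hε hε' (phase_eq_idle hidle)⟩
  have hspace := hrun.phaseInv.space_le hε hε'
  rwa [hvolume, hrun.maxLen_eq] at hspace
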